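/- Theorem 1.4. Let $(M,g)$ be a compact connected $1$-dimensional smooth Riemannian manifold without boundary, with Riemannian volume measure $dx$; write $|A|$ for the volume of $A\subset M$. (i) There are $L>0$ and a smooth diffeomorphism $\Phi:\mathbb{R}/L\mathbb{Z}\to M$ which is an isometry from the flat circle $(\mathbb{R}/L\mathbb{Z},ds^2)$ of length $L$ onto $(M,g)$; the parametrization $s\mapsto\Phi(s)$ is by arc length ($|\Phi'(s)|_g=1$ for all $s$), and $|M|=L$. Consequently, let $(e_j)_{j\ge 0}$ be any orthonormal basis of $L^2(M)=L^2(M;\mathbb{C})$ consisting of smooth eigenfunctions of the Laplace-Beltrami operator, $-\Delta_g e_j=\lambda_j^2e_j$ with $0=\lambda_0\le\lambda_1\le\cdots$. Then the following hold. (ii) For every real $\lambda$ the set $\{j:\lambda_j=\lambda\}$ is finite, and for every $x\in M$ $$\sum_{j:\lambda_j=\lambda}|e_j(x)|^2=\frac{\#\{j:\lambda_j=\lambda\}}{|M|}.$$ (iii) Let $E\subset M$ be measurable, let $S$ be a finite subset of the spectrum $\{\lambda_j:j\ge 0\}$, and let $X_S=\{j:\lambda_j\in S\}$. Let $0\le\epsilon<1$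 and $0\le\epsilon'<1$ satisfy $0<1-\epsilon-\epsilon'\le 1$. Let $f\in L^2(M)$, $f\ne 0$, with $\widehat f(j)=\langle f,e_j\rangle=\int_M f\,\overline{e_j}\,dx$, satisfy $$\int_E|f(x)|^2\,dx\ge(1-\epsilon)\|f\|_{L^2(M)}^2\quad\text{and}\quad\sum_{j\in X_S}|\widehat f(j)|^2\ge(1-\epsilon')\|f\|_{L^2(M)}^2 .$$ Then $$(1-\epsilon-\epsilon')^2\le\frac{|E|}{|M|}\,\#X_S.$$ -/

import Mathlib

open Set MeasureTheory Manifold Bundle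
open scoped ContDiff Topology ENNReal

/-! ### The flat circle `ℝ / Lℤ` as a Riemannian manifold -/

noncomputable section FlatCircle

variable (L : ℝ) [hL : Fact (0 < L)]

/-- The chart of `ℝ / Lℤ` which inverts the projection `ℝ → ℝ / Lℤ` on `(a, a + L)`. -/
def flatCircleChart (a : ℝ) : OpenPartialHomeomorph (AddCircle L) ℝ :=
  (AddCircle.openPartialHomeomorphCoe L a).symm

/-- The atlas of `ℝ / Lℤ` given by the local inverses of the projection `ℝ → ℝ / Lℤ`. The preferred
chart at the class of `t ∈ [0, L)` has range `(t - L / 2, t + L / 2)`. -/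
instance flatCircleChartedSpace : ChartedSpace ℝ (AddCircle L) where
  atlas := range (flatCircleChart L)
  chartAt x := flatCircleChart L ((AddCircle.equivIco L 0 x : ℝ) - L / 2)
  mem_chart_source x := by
    have h0 : 0 < L := hL.out
    have h := (AddCircle.openPartialHomeomorphCoe L
      ((AddCircle.equivIco L 0 x : ℝ) - L / 2)).map_source
      (x := (AddCircle.equivIco L 0 x : ℝ)) ⟨by linarith, by linarith⟩
    rwa [AddCircle.openPartialHomeomorphCoe_apply, AddCircle.coe_equivIco] at h
  chart_mem_atlas _ := mem_range_self _

/-- The projection `ℝ → ℝ / Lℤ` composed with a chart is the identity up to a period. -/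
theorem coe_flatCircleChart (a : ℝ) {x : AddCircle L} (hx : x ∈ (flatCircleChart L a).source) :
    ((flatCircleChart L a x : ℝ) : AddCircle L) = x :=
  (AddCircle.openPartialHomeomorphCoe L a).right_inv hx

/-- The changes of charts of `ℝ / Lℤ` are locally translations, hence smooth. -/
instance flatCircle_isManifold : IsManifold 𝓘(ℝ, ℝ) ∞ (AddCircle L) := by
  have h0 : 0 < L := hL.out
  refine isManifold_of_contDiffOn _ _ _ ?_
  rintro _ _ ⟨a, rfl⟩ ⟨b, rfl⟩
  simp only [modelWithCornersSelf_coe, modelWithCornersSelf_coe_symm, Function.comp_id,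
    Function.id_comp, range_id, inter_univ, preimage_id]
  set T := (flatCircleChart L a).symm ≫ₕ flatCircleChart L b with hT
  have key : ∀ t ∈ T.source, ∃ k : ℤ, T t - t = k * L := by
    intro t ht
    have ht2 : ((t : ℝ) : AddCircle L) ∈ (flatCircleChart L b).source := by
      have := ht.2
      exact this
    have h1 : ((T t : ℝ) : AddCircle L) = (t : AddCircle L) := coe_flatCircleChart L b ht2
    have h2 : ((T t - t : ℝ) : AddCircle L) = 0 := by
      rw [AddCircle.coe_sub, h1, sub_self]
    obtain ⟨k, hk⟩ := (AddCircle.coe_eq_zero_iff L).1 h2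
    exact ⟨k, by rw [← hk]; simp⟩
  intro t ht
  refine ContDiffAt.contDiffWithinAt ?_
  have hcont : ContinuousAt (fun s => T s - s) t :=
    (T.continuousAt ht).sub continuousAt_id
  have hev : ∀ᶠ s in 𝓝 t, T s = s + (T t - t) := by
    have h1 : ∀ᶠ s in 𝓝 t, |(T s - s) - (T t - t)| < L := by
      have := (Metric.continuousAt_iff'.1 hcont) L h0
      exact this
    filter_upwards [h1, T.open_source.mem_nhds ht] with s hs hsT
    obtain ⟨k, hk⟩ := key s hsT
    obtain ⟨m, hm⟩ := key t ht
    rw [hk, hm, ← sub_mul, abs_mul, abs_of_pos h0] at hs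
    have h3 : |((k - m : ℤ) : ℝ)| < 1 := by
      push_cast
      by_contra! hcon
      nlinarith
    have h4 : k - m = 0 := by
      rw [← Int.abs_lt_one_iff]
      exact_mod_cast h3
    have h5 : k = m := by omega
    rw [hm, ← h5, ← hk]
    ring
  exact (contDiffAt_id.add contDiffAt_const).congr_of_eventuallyEq hev

/-- The flat metric `ds²` on `ℝ / Lℤ`: in the charts above every tangent space is `ℝ`, with its usual
inner product. -/
def flatCircleMetric :
    RiemannianMetric (fun x : AddCircle L ↦ TangentSpace 𝓘(ℝ, ℝ) x) where
  inner _ := (innerSL ℝ : ℝ →L[ℝ] ℝ →L[ℝ] ℝ)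
  symm _ v w := real_inner_comm (F := ℝ) w v
  pos _ v hv := real_inner_self_pos (F := ℝ) |>.2 hv
  continuousAt _ := by
    change ContinuousAt (fun v : ℝ ↦ (inner ℝ v v : ℝ)) 0
    fun_prop
  isVonNBounded _ := by
    change Bornology.IsVonNBounded ℝ {v : ℝ | (inner ℝ v v : ℝ) < 1}
    have h : {v : ℝ | (inner ℝ v v : ℝ) < 1} = Metric.ball (0 : ℝ) 1 := by
      ext v
      rw [mem_ofPred_eq, Metric.mem_ball, dist_zero_right, real_inner_self_eq_norm_sq]
      exact sq_lt_one_iff₀ (norm_nonneg v)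
    rw [h]
    exact NormedSpace.isVonNBounded_ball ℝ ℝ 1

instance flatCircleRiemannianBundle :
    RiemannianBundle (fun x : AddCircle L ↦ TangentSpace 𝓘(ℝ, ℝ) x) := ⟨flatCircleMetric L⟩

end FlatCircle

/-! ### Riemannian isometries -/

section Isometry

variable {E₁ E₂ H₁ H₂ M₁ M₂ : Type*}
  [NormedAddCommGroup E₁] [NormedSpace ℝ E₁] [TopologicalSpace H₁]
  {I₁ : ModelWithCorners ℝ E₁ H₁} [TopologicalSpace M₁] [ChartedSpace H₁ M₁]
  [RiemannianBundle (fun x : M₁ ↦ TangentSpace I₁ x)]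
  [NormedAddCommGroup E₂] [NormedSpace ℝ E₂] [TopologicalSpace H₂]
  {I₂ : ModelWithCorners ℝ E₂ H₂} [TopologicalSpace M₂] [ChartedSpace H₂ M₂]
  [RiemannianBundle (fun x : M₂ ↦ TangentSpace I₂ x)]

/-- A diffeomorphism is an isometry of Riemannian manifolds if it pulls the metric of the target
back to the metric of the source. -/
def IsRiemannianIsometry (Φ : M₁ ≃ₘ^∞⟮I₁, I₂⟯ M₂) : Prop :=
  ∀ (x : M₁) (v w : TangentSpace I₁ x),
    inner ℝ (mfderiv I₁ I₂ Φ x v) (mfderiv I₁ I₂ Φ x w) = inner ℝ v w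

end Isometry

/-! ### Riemannian volume, Laplace-Beltrami operator and eigenbases -/

noncomputable section Laplace

variable (n : ℕ) {M : Type*} [TopologicalSpace M] [ChartedSpace (EuclideanSpace ℝ (Fin n)) M]
  [RiemannianBundle (fun x : M ↦ TangentSpace (𝓡 n) x)]

/-- The coordinate vector field `∂ᵢ` of the preferred chart at `p`, at the point with
coordinates `y`. -/
def coordVector (p : M) (i : Fin n) (y : EuclideanSpace ℝ (Fin n)) :
    TangentSpace (𝓡 n) ((extChartAt (𝓡 n) p).symm y) :=
  mfderiv 𝓘(ℝ, EuclideanSpace ℝ (Fin n)) (𝓡 n) (extChartAt (𝓡 n) p).symm y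
    (EuclideanSpace.single i (1 : ℝ))

/-- The matrix `gᵢⱼ(y) = ⟨∂ᵢ, ∂ⱼ⟩` of the metric in the preferred chart at `p`. -/
def metricMatrix (p : M) (y : EuclideanSpace ℝ (Fin n)) : Matrix (Fin n) (Fin n) ℝ :=
  Matrix.of fun i j ↦ inner ℝ (coordVector n p i y) (coordVector n p j y)

/-- The density `√(det g(y))` of the Riemannian volume in the preferred chart at `p`. -/
def volumeDensity (p : M) (y : EuclideanSpace ℝ (Fin n)) : ℝ :=
  √(metricMatrix n p y).det

/-- The Riemannian volume on the domain of the preferred chart at `p`, namely `√(det g(y)) dy`,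
extended by zero to a measure on `M`. -/
def chartVolume [MeasurableSpace M] (p : M) : Measure M :=
  ((volume.restrict (extChartAt (𝓡 n) p).target).withDensity
    fun y ↦ ENNReal.ofReal (volumeDensity n p y)).map (extChartAt (𝓡 n) p).symm

/-- The Riemannian volume measure `dx`. The measures `chartVolume n p` agree on the overlaps of the
chart domains, so their supremum is the measure which restricts to each of them. -/
def riemannianVolume (M : Type*) [TopologicalSpace M] [ChartedSpace (EuclideanSpace ℝ (Fin n)) M]
    [RiemannianBundle (fun x : M ↦ TangentSpace (𝓡 n) x)] [MeasurableSpace M] : Measure M :=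
  ⨆ p : M, chartVolume n p

/-- The Laplace-Beltrami operator
`Δ f = (det g)^(-1/2) ∑ᵢ ∂ᵢ (∑ⱼ (det g)^(1/2) gⁱʲ ∂ⱼ f)`, computed at `p` in the preferred chart
at `p`. -/
def laplaceBeltrami (f : M → ℂ) (p : M) : ℂ :=
  (volumeDensity n p (extChartAt (𝓡 n) p p))⁻¹ •
    ∑ i : Fin n,
      fderiv ℝ
        (fun y ↦ ∑ j : Fin n, (volumeDensity n p y * (metricMatrix n p y)⁻¹ i j) •
          fderiv ℝ (f ∘ (extChartAt (𝓡 n) p).symm) y (EuclideanSpace.single j (1 : ℝ)))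
        (extChartAt (𝓡 n) p p) (EuclideanSpace.single i (1 : ℝ))

/-- An orthonormal basis `(eⱼ)` of `L²(M)` consisting of (smooth, complex-valued) eigenfunctions,
`-Δ eⱼ = λⱼ² eⱼ` with `0 = λ₀ ≤ λ₁ ≤ ⋯`. -/
structure LaplaceEigenbasis (M : Type*) [TopologicalSpace M]
    [ChartedSpace (EuclideanSpace ℝ (Fin n)) M]
    [RiemannianBundle (fun x : M ↦ TangentSpace (𝓡 n) x)] [MeasurableSpace M] where
  /-- The eigenfunctions `eⱼ`. -/
  e : ℕ → M → ℂ
  /-- The frequencies `λⱼ`. -/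
  freq : ℕ → ℝ
  /-- The orthonormal basis of `L²(M)` formed by the classes of the `eⱼ`. -/
  basis : HilbertBasis ℕ ℂ (Lp ℂ 2 (riemannianVolume n M))
  basis_ae_eq : ∀ j, basis j =ᵐ[riemannianVolume n M] e j
  contMDiff : ∀ j, ContMDiff (𝓡 n) 𝓘(ℝ, ℂ) ∞ (e j)
  eigen : ∀ j x, -laplaceBeltrami n (e j) x = (freq j : ℂ) ^ 2 * e j x
  freq_zero : freq 0 = 0
  freq_mono : Monotone freq

variable {n} [MeasurableSpace M]

/-- The Fourier coefficient `⟨f, eⱼ⟩ = ∫ f ēⱼ` of `f ∈ L²(M)`. -/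
def LaplaceEigenbasis.coeff (B : LaplaceEigenbasis n M) (f : Lp ℂ 2 (riemannianVolume n M))
    (j : ℕ) : ℂ :=
  inner ℂ (B.basis j) f

/-- `X_S`, the set of indices `j` with `λⱼ ∈ S`. -/
def LaplaceEigenbasis.indexSet (B : LaplaceEigenbasis n M) (S : Set ℝ) : Set ℕ :=
  {j | B.freq j ∈ S}

end Laplace

/-! Everything is read along a unit speed curve. Composing a chart with a primitive of the speed of
its inverse gives an arc length chart (`exists_arclengthChart`). In such a chart a unit speed curve
is locally `s ↦ b ± s`, so two unit speed curves through a common point agree near it up to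
translation and reflection (`eventually_eq_of_isUnitSpeedAt`). This rigidity replaces uniqueness for
differential equations. Compactness bounds below the length of local unit speed curves, so they
prolong to a curve `γ` on the whole line, whose range is open and closed, hence all of `M`. A
coincidence `γ a = γ b` forces the period `b - a` (`periodic_of_eq`), and `γ` is not injective
because `M` is compact. The periods therefore form a group `Lℤ` with `L > 0`, and `γ` descends to an
isometry from the circle.

Through `γ` the volume becomes length on `(0, L]` and the Laplacian becomes `d²/dt²`, so an
eigenbasis becomes a `PeriodicEigenbasis`. Solutions of `h'' = -λ²h` are determined by `(h 0, h'
0)`, whence finite multiplicity. On one eigenspace `d/dt` acts by an anti-Hermitian matrix in the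
orthonormal basis, so `∑ |h_j|²` has derivative zero; integration over a period gives its value
(`sum_norm_sq_eq`). Explicit exponentials are never needed.

For the concentration inequality, let `Q` be the cutoff to `E` and `P` the projection onto the span
of the chosen eigenfunctions. The two hypotheses force the Hilbert-Schmidt norm of `QP` to be at
least `1 - ε - ε'` (`sq_le_sum_norm_sq_of_concentrated`). Its square is `∑ ∫_E |e_j|²`, which the
constancy of `∑ |e_j|²` evaluates exactly. -/

/-! ### Primitives of positive smooth functions -/

/-- A positive smooth function on an open subset of the line has, near each point, a primitive which
is a smooth diffeomorphism between open subsets of the line. -/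
theorem exists_openPartialHomeomorph_hasDerivAt {T : Set ℝ} (hT : IsOpen T) {ρ : ℝ → ℝ}
    (hρ : ContDiffOn ℝ ∞ ρ T) (hpos : ∀ r ∈ T, 0 < ρ r) {a : ℝ} (ha : a ∈ T) :
    ∃ σ : OpenPartialHomeomorph ℝ ℝ, a ∈ σ.source ∧ σ.source ⊆ T ∧ σ a = 0 ∧
      (∀ r ∈ σ.source, HasDerivAt σ (ρ r) r) ∧ ContDiffOn ℝ ∞ σ σ.source ∧
      ContDiffOn ℝ ∞ σ.symm σ.target := by
  obtain ⟨δ, hδ, hB⟩ := Metric.isOpen_iff.1 hT a ha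
  set B := Metric.ball a δ with hBdef
  have haB : a ∈ B := Metric.mem_ball_self hδ
  have hcont : ContinuousOn ρ B := hρ.continuousOn.mono hB
  set F : ℝ → ℝ := fun u ↦ ∫ x in a..u, ρ x with hF
  have hder : ∀ r ∈ B, HasDerivAt F (ρ r) r := by
    intro r hr
    have hseg : uIcc a r ⊆ B := by
      have : OrdConnected B := by rw [hBdef, Real.ball_eq_Ioo]; infer_instance
      exact this.uIcc_subset haB hr
    refine intervalIntegral.integral_hasDerivAt_right ?_ ?_ ?_
    · exact (hcont.mono hseg).intervalIntegrable
    · exact hcont.stronglyMeasurableAtFilter Metric.isOpen_ball r hr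
    · exact hcont.continuousAt (Metric.isOpen_ball.mem_nhds hr)
  have hsm : ContDiffOn ℝ ∞ F B := by
    rw [contDiffOn_infty_iff_deriv_of_isOpen Metric.isOpen_ball]
    refine ⟨fun r hr ↦ (hder r hr).differentiableAt.differentiableWithinAt, ?_⟩
    exact (hρ.mono hB).congr fun r hr ↦ (hder r hr).deriv
  have hsa : ContDiffAt ℝ ∞ F a := hsm.contDiffAt (Metric.isOpen_ball.mem_nhds haB)
  have hfa : HasFDerivAt F
      ((ContinuousLinearEquiv.unitsEquivAut ℝ (Units.mk0 (ρ a) (hpos a ha).ne') : ℝ ≃L[ℝ] ℝ) :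
        ℝ →L[ℝ] ℝ) a := by
    refine HasFDerivAt.congr_fderiv (hder a haB).hasFDerivAt (ContinuousLinearMap.ext_ring ?_)
    simp
  -- Inverse function theorem at `a`, where `F' = ρ a ≠ 0`. The restriction to the ball makes `F' =
  -- ρ` available on the whole source.
  set σ₀ := hsa.toOpenPartialHomeomorph F hfa (by simp) with hσ₀
  set σ := σ₀.restrOpen B Metric.isOpen_ball with hσ
  have hcoe : ∀ r, σ r = F r := fun r ↦ rfl
  have hcoe' : (σ : ℝ → ℝ) = F := rfl
  have hsrc : σ.source ⊆ B := inter_subset_right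
  refine ⟨σ, ⟨hsa.mem_toOpenPartialHomeomorph_source hfa (by simp), haB⟩, hsrc.trans hB, ?_,
    fun r hr ↦ hder r (hsrc hr), hsm.mono hsrc, fun s hs ↦ ContDiffAt.contDiffWithinAt ?_⟩
  · rw [hcoe, hF]; simp
  · have hs' : σ.symm s ∈ B := hsrc (σ.map_target hs)
    exact σ.contDiffAt_symm_deriv (hpos _ (hB hs')).ne' hs (hder _ hs')
      (hsm.contDiffAt (Metric.isOpen_ball.mem_nhds hs'))

/-! ### One-dimensional charts with values in the line -/

noncomputable section LineChart

/-- The isometry between the line and the one-dimensional Euclidean space. -/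
def lineIso : ℝ ≃ₗᵢ[ℝ] EuclideanSpace ℝ (Fin 1) where
  toFun r := EuclideanSpace.single 0 r
  invFun v := v 0
  map_add' a b := by ext i; fin_cases i; simp
  map_smul' a b := by ext i; fin_cases i; simp
  left_inv r := by simp
  right_inv v := by ext i; fin_cases i; simp
  norm_map' r := by simp

theorem contDiff_lineIso {n : WithTop ℕ∞} : ContDiff ℝ n lineIso :=
  lineIso.toContinuousLinearEquiv.contDiff

theorem contDiff_lineIso_symm {n : WithTop ℕ∞} : ContDiff ℝ n lineIso.symm :=
  lineIso.symm.toContinuousLinearEquiv.contDiff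

variable {M : Type*} [TopologicalSpace M] [ChartedSpace (EuclideanSpace ℝ (Fin 1)) M]

/-- The preferred chart at `p`, with values in the line. -/
def lineChart (p : M) : OpenPartialHomeomorph M ℝ :=
  (chartAt (EuclideanSpace ℝ (Fin 1)) p).trans
    lineIso.symm.toHomeomorph.toOpenPartialHomeomorph

theorem mem_lineChart_source (p : M) : p ∈ (lineChart p).source := by
  simp [lineChart]

theorem lineChart_source (p : M) : (lineChart p).source = (extChartAt (𝓡 1) p).source := by
  simp [lineChart]

theorem lineChart_apply (p x : M) : lineChart p x = lineIso.symm (extChartAt (𝓡 1) p x) := rfl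

theorem lineChart_symm_apply (p : M) (r : ℝ) :
    (lineChart p).symm r = (extChartAt (𝓡 1) p).symm (lineIso r) := rfl

theorem mem_lineChart_target (p : M) (r : ℝ) :
    r ∈ (lineChart p).target ↔ lineIso r ∈ (extChartAt (𝓡 1) p).target := by
  simp [lineChart]

section Speed

variable [RiemannianBundle (fun x : M ↦ TangentSpace (𝓡 1) x)]

/-- The speed `‖γ'(t)‖` of a curve. -/
def speed (γ : ℝ → M) (t : ℝ) : ℝ := ‖mfderiv 𝓘(ℝ, ℝ) (𝓡 1) γ t (1 : ℝ)‖

/-- The two derivatives lie in fibres over points that are only propositionally equal, and the norm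
depends on the fibre; hence the passage through `HEq`. -/
theorem Filter.EventuallyEq.speed_eq {γ γ' : ℝ → M} {t : ℝ} (h : γ =ᶠ[𝓝 t] γ') :
    speed γ t = speed γ' t := by
  unfold speed
  have h1 := h.mfderiv_eq (I := 𝓘(ℝ, ℝ)) (I' := 𝓡 1)
  have h2 := h.eq_of_nhds
  have key : ∀ (x y : M) (v : TangentSpace (𝓡 1) x) (w : TangentSpace (𝓡 1) y), x = y →
      HEq v w → ‖v‖ = ‖w‖ := by
    rintro x _ v w rfl h
    rw [eq_of_heq h]
  refine key _ _ _ _ h2 ?_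
  have h3 : (mfderiv 𝓘(ℝ, ℝ) (𝓡 1) γ t : ℝ → EuclideanSpace ℝ (Fin 1)) (1 : ℝ) =
    (mfderiv 𝓘(ℝ, ℝ) (𝓡 1) γ' t : ℝ → EuclideanSpace ℝ (Fin 1)) (1 : ℝ) := by
      exact congrArg (fun L : ℝ →L[ℝ] EuclideanSpace ℝ (Fin 1) ↦ L 1) h1
  exact heq_of_eq h3

/-- The speed of a reparametrized curve. -/
theorem speed_comp {γ : ℝ → M} {φ : ℝ → ℝ} {t φ' : ℝ}
    (hγ : MDifferentiableAt 𝓘(ℝ, ℝ) (𝓡 1) γ (φ t)) (hφ : HasDerivAt φ φ' t) :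
    speed (γ ∘ φ) t = |φ'| * speed γ (φ t) := by
  unfold speed
  have h1 := mfderiv_comp t hγ hφ.differentiableAt.mdifferentiableAt
  have h2 : mfderiv 𝓘(ℝ, ℝ) 𝓘(ℝ, ℝ) φ t (1 : ℝ) = φ' := by
    rw [mfderiv_eq_fderiv]
    exact hφ.deriv
  have h3 : mfderiv 𝓘(ℝ, ℝ) (𝓡 1) (γ ∘ φ) t (1 : ℝ) =
      φ' • mfderiv 𝓘(ℝ, ℝ) (𝓡 1) γ (φ t) (1 : ℝ) := by
    rw [h1]
    change mfderiv 𝓘(ℝ, ℝ) (𝓡 1) γ (φ t) (mfderiv 𝓘(ℝ, ℝ) 𝓘(ℝ, ℝ) φ t (1 : ℝ)) = _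
    rw [h2]
    have := (mfderiv 𝓘(ℝ, ℝ) (𝓡 1) γ (φ t)).map_smul φ' (1 : ℝ)
    rw [← this]
    congr 1
    exact (mul_one φ').symm
  rw [h3]
  exact norm_smul _ _

end Speed

variable [IsManifold (𝓡 1) ∞ M]

theorem contMDiffOn_lineChart (p : M) :
    ContMDiffOn (𝓡 1) 𝓘(ℝ, ℝ) ∞ (lineChart p) (lineChart p).source := by
  have h1 : ContMDiff 𝓘(ℝ, EuclideanSpace ℝ (Fin 1)) 𝓘(ℝ, ℝ) ∞ lineIso.symm :=
    contDiff_lineIso_symm.contMDiff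
  have h2 := contMDiffOn_extChartAt (I := 𝓡 1) (n := ∞) (x := p)
  rw [← extChartAt_source (𝓡 1), ← lineChart_source] at h2
  exact h1.comp_contMDiffOn h2

theorem contMDiffOn_lineChart_symm (p : M) :
    ContMDiffOn 𝓘(ℝ, ℝ) (𝓡 1) ∞ (lineChart p).symm (lineChart p).target := by
  have h1 : ContMDiff 𝓘(ℝ, ℝ) 𝓘(ℝ, EuclideanSpace ℝ (Fin 1)) ∞ lineIso :=
    contDiff_lineIso.contMDiff
  have h2 := contMDiffOn_extChartAt_symm (I := 𝓡 1) (n := ∞) p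
  exact h2.comp h1.contMDiffOn fun r hr ↦ (mem_lineChart_target p r).1 hr

variable [RiemannianBundle (fun x : M ↦ TangentSpace (𝓡 1) x)]

variable [IsContMDiffRiemannianBundle (𝓡 1) ∞ (EuclideanSpace ℝ (Fin 1))
      (fun x : M ↦ TangentSpace (𝓡 1) x)]

/-- The square of the speed of a smooth curve is smooth. -/
theorem contDiffOn_speed_sq {γ : ℝ → M} {s : Set ℝ} (hs : IsOpen s)
    (hγ : ContMDiffOn 𝓘(ℝ, ℝ) (𝓡 1) ∞ γ s) : ContDiffOn ℝ ∞ (fun t ↦ speed γ t ^ 2) s := by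
  have : IsManifold (𝓡 1) 1 M := .of_le (n := ∞) (by simp)
  -- The velocity lift is the tangent map applied to the unit section of `Tℝ`; pairing it with
  -- itself in the smooth metric gives the squared speed.
  have h1 := hγ.contMDiffOn_tangentMapWithin (m := ∞) (by simp) hs.uniqueMDiffOn
  have h2 : ContMDiff 𝓘(ℝ, ℝ) (𝓘(ℝ, ℝ).tangent) ∞
      (fun t : ℝ ↦ (⟨t, (1 : ℝ)⟩ : TangentBundle 𝓘(ℝ, ℝ) ℝ)) := by
    rw [contMDiff_vectorSpace_iff_contDiff (V := fun _ ↦ (1 : ℝ))]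
    exact contDiff_const
  have h3 := h1.comp (h2.contMDiffOn (s := s)) fun t ht ↦ ht
  have h4 : ContMDiffOn 𝓘(ℝ, ℝ) (𝓡 1).tangent ∞ (fun t ↦ (⟨γ t,
      mfderiv 𝓘(ℝ, ℝ) (𝓡 1) γ t (1 : ℝ)⟩ : TangentBundle (𝓡 1) M)) s := by
    refine h3.congr fun t ht ↦ ?_
    simp only [Function.comp, tangentMapWithin]
    rw [mfderivWithin_of_isOpen hs ht]
  have h5 := ContMDiffOn.inner_bundle (F := EuclideanSpace ℝ (Fin 1)) h4 h4
  rw [contMDiffOn_iff_contDiffOn] at h5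
  refine h5.congr fun t _ ↦ ?_
  exact (real_inner_self_eq_norm_sq _).symm

end LineChart

/-! ### Unit speed curves -/

section UnitSpeed

variable {M : Type*} [TopologicalSpace M] [ChartedSpace (EuclideanSpace ℝ (Fin 1)) M]
  [RiemannianBundle (fun x : M ↦ TangentSpace (𝓡 1) x)]

/-- The curve `γ` is smooth at `t`, with `‖γ'(t)‖ = 1`. -/
def IsUnitSpeedAt (γ : ℝ → M) (t : ℝ) : Prop :=
  ContMDiffAt 𝓘(ℝ, ℝ) (𝓡 1) ∞ γ t ∧ speed γ t = 1

theorem IsUnitSpeedAt.congr {γ γ' : ℝ → M} {t : ℝ} (h : IsUnitSpeedAt γ t) (h' : γ' =ᶠ[𝓝 t] γ) :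
    IsUnitSpeedAt γ' t :=
  ⟨h.1.congr_of_eventuallyEq h', h'.speed_eq.trans h.2⟩

theorem IsUnitSpeedAt.mdifferentiableAt {γ : ℝ → M} {t : ℝ} (h : IsUnitSpeedAt γ t) :
    MDifferentiableAt 𝓘(ℝ, ℝ) (𝓡 1) γ t := h.1.mdifferentiableAt (by simp)

/-- Reparametrization of a curve by an isometry of the line. -/
theorem IsUnitSpeedAt.comp_affine {γ : ℝ → M} {a b t : ℝ} (ha : |a| = 1)
    (h : IsUnitSpeedAt γ (a * t + b)) : IsUnitSpeedAt (fun s ↦ γ (a * s + b)) t := by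
  have hd : HasDerivAt (fun s ↦ a * s + b) a t := by
    simpa using ((hasDerivAt_id t).const_mul a).add_const b
  have hc : ContDiff ℝ ∞ (fun s : ℝ ↦ a * s + b) := by fun_prop
  refine ⟨ContMDiffAt.comp t h.1 hc.contMDiff.contMDiffAt, ?_⟩
  have := speed_comp (φ := fun s ↦ a * s + b) h.mdifferentiableAt hd
  rw [ha, h.2, mul_one] at this
  exact this

/-- A function of one variable whose derivative takes the values `±1` is locally affine. -/
theorem eventually_eq_affine_of_abs_deriv_eq_one {w : ℝ → ℝ} {t : ℝ} (hw : ContDiffAt ℝ 1 w t)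
    (h : ∀ᶠ s in 𝓝 t, DifferentiableAt ℝ w s ∧ |deriv w s| = 1) :
    ∃ a : ℝ, |a| = 1 ∧ ∀ᶠ s in 𝓝 0, w (t + s) = w t + a * s := by
  have hcont : ContinuousAt (deriv w) t := by
    have h1 : ContinuousAt (fderiv ℝ w) t := (hw.fderiv_right (m := 0) (by simp)).continuousAt
    exact h1.clm_apply continuousAt_const
  -- The values `1` and `-1` are at distance `2`, so closeness forces equality of the derivatives.
  have h1 : ∀ᶠ s in 𝓝 t, |deriv w s - deriv w t| < 1 := Metric.continuousAt_iff'.1 hcont 1 one_pos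
  have h2 : ∀ᶠ s in 𝓝 t, HasDerivAt w (deriv w t) s := by
    filter_upwards [h, h1] with s hs hs1
    have h3 : deriv w s = deriv w t := by
      rcases eq_or_eq_neg_of_abs_eq hs.2 with h4 | h4 <;>
      rcases eq_or_eq_neg_of_abs_eq h.self_of_nhds.2 with h5 | h5 <;>
      first | exact h4.trans h5.symm | (rw [h4, h5] at hs1; norm_num at hs1)
    rw [← h3]
    exact hs.1.hasDerivAt
  obtain ⟨δ, hδ, hball⟩ := Metric.eventually_nhds_iff_ball.1 h2
  refine ⟨deriv w t, h.self_of_nhds.2, ?_⟩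
  filter_upwards [Metric.ball_mem_nhds (0 : ℝ) hδ] with s hs
  have hderiv : ∀ r ∈ Metric.ball t δ,
      HasDerivWithinAt (fun r ↦ w r - deriv w t * r) 0 (Metric.ball t δ) r := by
    intro r hr
    have := (hball r hr).sub ((hasDerivAt_id r).const_mul (deriv w t))
    simp only [mul_one, sub_self, id] at this
    exact this.hasDerivWithinAt
  have hs' : t + s ∈ Metric.ball t δ := by simpa using hs
  have := (convex_ball t δ).is_const_of_fderivWithin_eq_zero (𝕜 := ℝ)
    (f := fun r ↦ w r - deriv w t * r)
    (fun r hr ↦ (hderiv r hr).differentiableWithinAt) (fun r hr ↦ by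
      have h0 := (hderiv r hr).hasFDerivWithinAt.fderivWithin
        (Metric.isOpen_ball.uniqueDiffWithinAt hr)
      rw [h0]; ext; simp) hs' (Metric.mem_ball_self hδ)
  linarith

/-- A unit speed curve is, in an arc length chart, an isometry of the line. -/
theorem eventually_eq_arclengthChart_symm {c : OpenPartialHomeomorph M ℝ}
    (hc : ContMDiffOn (𝓡 1) 𝓘(ℝ, ℝ) ∞ c c.source) (hc' : ∀ s ∈ c.target, IsUnitSpeedAt c.symm s)
    {γ : ℝ → M} {t : ℝ} (hγ : ∀ᶠ s in 𝓝 t, IsUnitSpeedAt γ s) (ht : γ t ∈ c.source) :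
    ∃ a : ℝ, |a| = 1 ∧ ∀ᶠ s in 𝓝 0, γ (t + s) = c.symm (c (γ t) + a * s) := by
  have hcont : ContinuousAt γ t := hγ.self_of_nhds.1.continuousAt
  have hsrc : ∀ᶠ s in 𝓝 t, γ s ∈ c.source := hcont (c.open_source.mem_nhds ht)
  have hsm : ∀ᶠ s in 𝓝 t, ContDiffAt ℝ ∞ (c ∘ γ) s := by
    filter_upwards [hγ, hsrc] with s hs hs'
    exact contMDiffAt_iff_contDiffAt.1
      ((hc.contMDiffAt (c.open_source.mem_nhds hs')).comp s hs.1)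
  have hone : ∀ᶠ s in 𝓝 t, DifferentiableAt ℝ (c ∘ γ) s ∧ |deriv (c ∘ γ) s| = 1 := by
    filter_upwards [hγ, hsrc, hsm, hsrc.eventually_nhds] with s hs hs' hs'' hev
    have hd := hs''.differentiableAt (by simp)
    refine ⟨hd, ?_⟩
    have hu := hc' _ (c.map_source hs')
    -- Since `γ = c.symm ∘ (c ∘ γ)` locally and both curves have unit speed, the chain rule leaves
    -- only `|(c ∘ γ)'| = 1`.
    have h1 := speed_comp (φ := c ∘ γ) hu.mdifferentiableAt hd.hasDerivAt
    have h2 : c.symm ∘ c ∘ γ =ᶠ[𝓝 s] γ := by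
      filter_upwards [hev] with r hr using c.left_inv hr
    rw [h2.speed_eq, hs.2, Function.comp, hu.2, mul_one] at h1
    exact h1.symm
  obtain ⟨a, ha, h⟩ := eventually_eq_affine_of_abs_deriv_eq_one
    (hsm.self_of_nhds.of_le (by simp)) hone
  refine ⟨a, ha, ?_⟩
  have hshift : Filter.Tendsto (fun s : ℝ ↦ t + s) (𝓝 0) (𝓝 t) := by
    have : Continuous (fun s : ℝ ↦ t + s) := by fun_prop
    simpa using this.tendsto 0
  filter_upwards [h, hshift.eventually hsrc] with s hs hs'
  rw [← c.left_inv hs', ← Function.comp_apply (f := c), hs, Function.comp]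

variable [IsManifold (𝓡 1) ∞ M]

/-- The chart composed with its inverse is locally the identity, so the derivative of the inverse
cannot kill the unit vector. -/
theorem speed_lineChart_symm_pos (p : M) {r : ℝ} (hr : r ∈ (lineChart p).target) :
    0 < speed (lineChart p).symm r := by
  refine norm_pos_iff.2 fun h0 ↦ ?_
  have hnhds := (lineChart p).open_target.mem_nhds hr
  have h1 : MDifferentiableAt 𝓘(ℝ, ℝ) (𝓡 1) (lineChart p).symm r :=
    ((contMDiffOn_lineChart_symm p).contMDiffAt hnhds).mdifferentiableAt (by simp)
  have h2 : MDifferentiableAt (𝓡 1) 𝓘(ℝ, ℝ) (lineChart p) ((lineChart p).symm r) :=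
    ((contMDiffOn_lineChart p).contMDiffAt ((lineChart p).open_source.mem_nhds
      ((lineChart p).map_target hr))).mdifferentiableAt (by simp)
  have h3 := mfderiv_comp r h2 h1
  have h4 : lineChart p ∘ (lineChart p).symm =ᶠ[𝓝 r] id := by
    filter_upwards [hnhds] with s hs using (lineChart p).right_inv hs
  rw [h4.mfderiv_eq, mfderiv_id] at h3
  have h5 := congrArg (fun L : ℝ →L[ℝ] ℝ ↦ L (1 : ℝ)) h3
  have h6 : (1 : ℝ) = mfderiv (𝓡 1) 𝓘(ℝ, ℝ) (lineChart p) ((lineChart p).symm r)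
    (mfderiv 𝓘(ℝ, ℝ) (𝓡 1) (lineChart p).symm r (1 : ℝ)) := h5
  rw [h0] at h6
  have h7 := (mfderiv (𝓡 1) 𝓘(ℝ, ℝ) (lineChart p) ((lineChart p).symm r)).map_zero
  exact one_ne_zero (α := ℝ) (h6.trans h7)

variable [IsContMDiffRiemannianBundle (𝓡 1) ∞ (EuclideanSpace ℝ (Fin 1))
      (fun x : M ↦ TangentSpace (𝓡 1) x)]

/-- Positivity keeps the squared speed away from the singularity of the square root. -/
theorem contDiffOn_speed_lineChart_symm (p : M) :
    ContDiffOn ℝ ∞ (speed (lineChart p).symm) (lineChart p).target := by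
  have h := (contDiffOn_speed_sq (lineChart p).open_target (contMDiffOn_lineChart_symm p)).sqrt
    fun r hr ↦ (pow_pos (speed_lineChart_symm_pos p hr) 2).ne'
  exact h.congr fun r hr ↦ (Real.sqrt_sq (speed_lineChart_symm_pos p hr).le).symm

/-- Near every point there is a chart whose inverse is parametrized by arc length. -/
theorem exists_arclengthChart (p : M) : ∃ c : OpenPartialHomeomorph M ℝ, p ∈ c.source ∧ c p = 0 ∧
    ContMDiffOn (𝓡 1) 𝓘(ℝ, ℝ) ∞ c c.source ∧ ∀ s ∈ c.target, IsUnitSpeedAt c.symm s := by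
  obtain ⟨σ, haσ, hσT, hσa, hσd, hσ, hσ'⟩ := exists_openPartialHomeomorph_hasDerivAt
    (lineChart p).open_target (contDiffOn_speed_lineChart_symm p)
    (fun r hr ↦ speed_lineChart_symm_pos p hr) ((lineChart p).map_source (mem_lineChart_source p))
  -- As `σ'` is the speed of the inverse chart, reparametrizing by `σ.symm` divides that speed by
  -- itself.
  refine ⟨(lineChart p).trans σ, ?_, hσa, ?_, ?_⟩
  · simpa using ⟨mem_lineChart_source p, haσ⟩
  · rw [OpenPartialHomeomorph.trans_source]
    exact (contMDiffOn_iff_contDiffOn.2 hσ).comp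
      ((contMDiffOn_lineChart p).mono inter_subset_left) fun x hx ↦ hx.2
  · intro s hs
    have hsσ : s ∈ σ.target := by simpa using hs.1
    have hsrc : σ.symm s ∈ σ.source := σ.map_target hsσ
    have hder : HasDerivAt σ.symm (speed (lineChart p).symm (σ.symm s))⁻¹ s :=
      σ.hasDerivAt_symm hsσ (speed_lineChart_symm_pos p (hσT hsrc)).ne' (hσd _ hsrc)
    have hsm : ContMDiffAt 𝓘(ℝ, ℝ) (𝓡 1) ∞ (lineChart p).symm (σ.symm s) :=
      (contMDiffOn_lineChart_symm p).contMDiffAt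
        ((lineChart p).open_target.mem_nhds (hσT hsrc))
    refine ⟨hsm.comp s (hσ'.contDiffAt (σ.open_target.mem_nhds hsσ)).contMDiffAt, ?_⟩
    have := speed_comp (hsm.mdifferentiableAt (by simp)) hder
    have hp := speed_lineChart_symm_pos p (hσT hsrc)
    rw [abs_of_pos (inv_pos.2 hp), inv_mul_cancel₀ hp.ne'] at this
    exact this

/-- Two unit speed curves through the same point differ by an isometry of the line. -/
theorem eventually_eq_of_isUnitSpeedAt {γ₁ γ₂ : ℝ → M} {t₁ t₂ : ℝ}
    (h₁ : ∀ᶠ s in 𝓝 t₁, IsUnitSpeedAt γ₁ s) (h₂ : ∀ᶠ s in 𝓝 t₂, IsUnitSpeedAt γ₂ s)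
    (h : γ₁ t₁ = γ₂ t₂) : ∃ a : ℝ, |a| = 1 ∧ ∀ᶠ s in 𝓝 0, γ₁ (t₁ + s) = γ₂ (t₂ + a * s) := by
  obtain ⟨c, hp, -, hc, hc'⟩ := exists_arclengthChart (γ₁ t₁)
  obtain ⟨a, ha, hA⟩ := eventually_eq_arclengthChart_symm hc hc' h₁ hp
  obtain ⟨b, hb, hB⟩ := eventually_eq_arclengthChart_symm hc hc' h₂ (h ▸ hp)
  have habs : |b * a| = 1 := by rw [abs_mul, ha, hb, one_mul]
  have hlim : Filter.Tendsto (fun s : ℝ ↦ b * a * s) (𝓝 0) (𝓝 0) := by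
    have : Continuous (fun s : ℝ ↦ b * a * s) := by fun_prop
    simpa using this.tendsto 0
  -- In the common chart the curves are `s ↦ x + a * s` and `s ↦ x + b * s`; a sign is its own
  -- inverse.
  refine ⟨b * a, habs, ?_⟩
  filter_upwards [hA, hlim.eventually hB] with s hs hs'
  have hbb : b * b = 1 := by rw [← abs_mul_abs_self, hb, one_mul]
  rw [hs, hs', h]
  congr 2
  linear_combination (-a * s) * hbb

/-- A unit speed curve has a smooth local inverse. -/
theorem exists_contMDiffAt_rightInverse {γ : ℝ → M} {t : ℝ}
    (hγ : ∀ᶠ s in 𝓝 t, IsUnitSpeedAt γ s) : ∃ v : M → ℝ, v (γ t) = t ∧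
      ContMDiffAt (𝓡 1) 𝓘(ℝ, ℝ) ∞ v (γ t) ∧ (∀ᶠ x in 𝓝 (γ t), γ (v x) = x) ∧
      ∀ᶠ s in 𝓝 t, v (γ s) = s := by
  obtain ⟨c, hp, hc0, hc, hc'⟩ := exists_arclengthChart (γ t)
  obtain ⟨a, ha, hA⟩ := eventually_eq_arclengthChart_symm hc hc' hγ hp
  have haa : a * a = 1 := by rw [← abs_mul_abs_self, ha, one_mul]
  have hcp : ContMDiffAt (𝓡 1) 𝓘(ℝ, ℝ) ∞ c (γ t) :=
    hc.contMDiffAt (c.open_source.mem_nhds hp)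
  have hlim : Filter.Tendsto (fun x ↦ a * c x) (𝓝 (γ t)) (𝓝 0) := by
    have : ContinuousAt (fun x ↦ a * c x) (γ t) := hcp.continuousAt.const_mul a
    simpa [ContinuousAt, hc0] using this
  have haff : ContDiff ℝ ∞ (fun r : ℝ ↦ t + a * r) := by fun_prop
  -- Near `t` the curve is `t + s ↦ c.symm (a * s)`, and `a⁻¹ = a`.
  refine ⟨fun x ↦ t + a * c x, by simp [hc0],
    haff.contMDiff.contMDiffAt.comp (γ t) hcp, ?_, ?_⟩
  · filter_upwards [hlim.eventually hA, c.open_source.mem_nhds hp] with x hx hx'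
    rw [hx, hc0, zero_add, ← mul_assoc, haa, one_mul, c.left_inv hx']
  · have hshift : Filter.Tendsto (fun s : ℝ ↦ s - t) (𝓝 t) (𝓝 0) := by
      have : Continuous (fun s : ℝ ↦ s - t) := by fun_prop
      simpa using this.tendsto t
    have htar : ∀ᶠ s in 𝓝 t, a * (s - t) ∈ c.target := by
      have : Continuous (fun s : ℝ ↦ a * (s - t)) := by fun_prop
      refine this.continuousAt (c.open_target.mem_nhds ?_)
      have := c.map_source hp
      rw [hc0] at this
      simpa using this
    filter_upwards [hshift.eventually hA, htar] with s hs hs'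
    rw [add_sub_cancel, hc0, zero_add] at hs
    rw [hs, c.right_inv hs', ← mul_assoc, haa]
    ring

/-- A unit speed curve is open. -/
theorem map_nhds_eq_of_isUnitSpeedAt {γ : ℝ → M} {t : ℝ}
    (hγ : ∀ᶠ s in 𝓝 t, IsUnitSpeedAt γ s) : Filter.map γ (𝓝 t) = 𝓝 (γ t) := by
  obtain ⟨v, hv, hsm, hr, -⟩ := exists_contMDiffAt_rightInverse hγ
  refine le_antisymm hγ.self_of_nhds.1.continuousAt ?_
  have hvt : Filter.Tendsto v (𝓝 (γ t)) (𝓝 t) := by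
    simpa [ContinuousAt, hv] using hsm.continuousAt
  calc 𝓝 (γ t) = Filter.map (γ ∘ v) (𝓝 (γ t)) := by
        rw [Filter.map_congr (show γ ∘ v =ᶠ[𝓝 (γ t)] id from hr), Filter.map_id]
    _ = Filter.map γ (Filter.map v (𝓝 (γ t))) := Filter.map_map.symm
    _ ≤ Filter.map γ (𝓝 t) := Filter.map_mono hvt

end UnitSpeed

/-! ### Extension of unit speed curves -/

section Extension

variable {M : Type*} [TopologicalSpace M] [ChartedSpace (EuclideanSpace ℝ (Fin 1)) M]
  [IsManifold (𝓡 1) ∞ M] [RiemannianBundle (fun x : M ↦ TangentSpace (𝓡 1) x)]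
  [IsContMDiffRiemannianBundle (𝓡 1) ∞ (EuclideanSpace ℝ (Fin 1))
    (fun x : M ↦ TangentSpace (𝓡 1) x)]

/-- The germ of a unit speed curve at a point determines the curve. -/
theorem eqOn_of_eventuallyEq_of_isUnitSpeedAt [T2Space M] {γ₁ γ₂ : ℝ → M} {U : Set ℝ}
    (hU : IsOpen U) (hU' : IsPreconnected U) (h₁ : ∀ t ∈ U, IsUnitSpeedAt γ₁ t)
    (h₂ : ∀ t ∈ U, IsUnitSpeedAt γ₂ t) {t₀ : ℝ} (ht₀ : t₀ ∈ U) (h : γ₁ =ᶠ[𝓝 t₀] γ₂) :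
    EqOn γ₁ γ₂ U := by
  -- Connectedness argument: agreement of germs is an open condition, so closedness in `U` is what
  -- must be shown.
  set V : Set ℝ := {t | γ₁ =ᶠ[𝓝 t] γ₂}
  have hV : IsOpen V := isOpen_setOfPred_eventually_nhds
  suffices hUV : U ⊆ V from fun t ht ↦ (hUV ht).self_of_nhds
  refine hU'.subset_of_closure_inter_subset hV ⟨t₀, ht₀, h⟩ ?_
  rintro t ⟨htV, htU⟩
  have hfreq : ∃ᶠ s in 𝓝 t, γ₁ =ᶠ[𝓝 s] γ₂ := mem_closure_iff_frequently.1 htV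
  have hev₁ : ∀ᶠ s in 𝓝 t, IsUnitSpeedAt γ₁ s :=
    Filter.eventually_of_mem (hU.mem_nhds htU) h₁
  have hev₂ : ∀ᶠ s in 𝓝 t, IsUnitSpeedAt γ₂ s :=
    Filter.eventually_of_mem (hU.mem_nhds htU) h₂
  have heq : γ₁ t = γ₂ t := by
    by_contra hne
    have : ∀ᶠ s in 𝓝 t, γ₁ s ≠ γ₂ s :=
      ((h₁ t htU).1.continuousAt.prodMk (h₂ t htU).1.continuousAt).eventually
        (isClosed_diagonal.isOpen_compl.mem_nhds hne)
    obtain ⟨s, hs, hs'⟩ := (hfreq.and_eventually this).exists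
    exact hs' hs.self_of_nhds
  obtain ⟨a, ha, hA⟩ := eventually_eq_of_isUnitSpeedAt hev₁ hev₂ heq
  have hsub : Filter.Tendsto (fun s : ℝ ↦ s - t) (𝓝 t) (𝓝 0) := by
    have : Continuous (fun s : ℝ ↦ s - t) := by fun_prop
    simpa using this.tendsto t
  rcases eq_or_eq_neg_of_abs_eq ha with rfl | rfl
  · filter_upwards [hsub.eventually hA] with s hs
    simpa using hs
  -- Reflected case: a point `s` near `t` with equal germs satisfies `γ₂ s = γ₂ (2t - s)`, so local
  -- injectivity gives `s = t`, and the germs agree at `t` after all.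
  · obtain ⟨v, -, -, -, hv⟩ := exists_contMDiffAt_rightInverse hev₂
    have hrefl : Filter.Tendsto (fun s : ℝ ↦ t + -1 * (s - t)) (𝓝 t) (𝓝 t) := by
      have : Continuous (fun s : ℝ ↦ t + -1 * (s - t)) := by fun_prop
      simpa using this.tendsto t
    obtain ⟨s, hs, hs1, hs2, hs3⟩ := (hfreq.and_eventually
      ((hsub.eventually hA).and (hv.and (hrefl.eventually hv)))).exists
    rw [add_sub_cancel, hs.self_of_nhds] at hs1
    rw [← hs1, hs2] at hs3
    have : s = t := by linarith
    rwa [this] at hs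

/-- Unit speed curves through each point exist. -/
theorem exists_isUnitSpeedAt_ball (p : M) : ∃ γ : ℝ → M, γ 0 = p ∧
    ∃ δ > 0, ∀ s, |s| < δ → IsUnitSpeedAt γ s := by
  obtain ⟨c, hp, hc0, -, hc'⟩ := exists_arclengthChart p
  obtain ⟨δ, hδ, hball⟩ := Metric.isOpen_iff.1 c.open_target _ (c.map_source hp)
  refine ⟨c.symm, by rw [← hc0, c.left_inv hp], δ, hδ, fun s hs ↦ hc' s (hball ?_)⟩
  simpa [hc0] using hs

/-- On a compact manifold, the size of the unit speed curves can be chosen uniformly. -/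
theorem exists_isUnitSpeedAt_uniform [CompactSpace M] : ∃ δ > 0, ∀ p : M, ∃ γ : ℝ → M, γ 0 = p ∧
    ∀ s, |s| < δ → IsUnitSpeedAt γ s := by
  suffices h : ∃ δ > 0, ∀ p ∈ (univ : Set M), ∃ γ : ℝ → M, γ 0 = p ∧
      ∀ s, |s| < δ → IsUnitSpeedAt γ s by simpa using h
  refine isCompact_univ.induction_on (p := fun K ↦ ∃ δ > 0, ∀ p ∈ K, ∃ γ : ℝ → M, γ 0 = p ∧
      ∀ s, |s| < δ → IsUnitSpeedAt γ s) ⟨1, one_pos, by simp⟩ ?_ ?_ ?_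
  · rintro s t hst ⟨δ, hδ, h⟩
    exact ⟨δ, hδ, fun p hp ↦ h p (hst hp)⟩
  · rintro s t ⟨δ, hδ, h⟩ ⟨δ', hδ', h'⟩
    refine ⟨min δ δ', lt_min hδ hδ', ?_⟩
    rintro p (hp | hp)
    · obtain ⟨γ, hγ, hs⟩ := h p hp
      exact ⟨γ, hγ, fun s hs' ↦ hs s (hs'.trans_le (min_le_left _ _))⟩
    · obtain ⟨γ, hγ, hs⟩ := h' p hp
      exact ⟨γ, hγ, fun s hs' ↦ hs s (hs'.trans_le (min_le_right _ _))⟩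
  · intro p _
    obtain ⟨γ, hγ0, δ, hδ, hγ⟩ := exists_isUnitSpeedAt_ball p
    have hev : ∀ᶠ s in 𝓝 0, IsUnitSpeedAt γ s := by
      filter_upwards [Metric.ball_mem_nhds (0 : ℝ) hδ] with s hs
      exact hγ s (by simpa using hs)
    have himg : γ '' Metric.ball 0 (δ / 2) ∈ 𝓝 p := by
      rw [← hγ0, ← map_nhds_eq_of_isUnitSpeedAt hev]
      exact Filter.image_mem_map (Metric.ball_mem_nhds _ (half_pos hδ))
    refine ⟨γ '' Metric.ball 0 (δ / 2), mem_nhdsWithin_of_mem_nhds himg, δ / 2, half_pos hδ, ?_⟩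
    rintro _ ⟨r, hr, rfl⟩
    -- Nearby points reuse the curve through `p`, recentred by `|r| < δ / 2`; half of its length
    -- remains.
    refine ⟨fun s ↦ γ (1 * s + r), by simp, fun s hs ↦ IsUnitSpeedAt.comp_affine (by simp)
      (hγ _ ?_)⟩
    rw [Metric.mem_ball, dist_zero_right, Real.norm_eq_abs] at hr
    calc |1 * s + r| ≤ |1 * s| + |r| := abs_add_le _ _
      _ < δ := by rw [one_mul]; linarith

/-- A unit speed curve can be prolonged to the right. -/
theorem exists_isUnitSpeedAt_extend_right {γ : ℝ → M} {a b t₀ δ : ℝ}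
    (hδ : ∀ p : M, ∃ γ : ℝ → M, γ 0 = p ∧ ∀ s, |s| < δ → IsUnitSpeedAt γ s)
    (hγ : ∀ s ∈ Ioo a b, IsUnitSpeedAt γ s) (ht₀ : t₀ ∈ Ioo a b) (hδ0 : 0 < δ) :
    ∃ γ' : ℝ → M, EqOn γ' γ (Iio t₀) ∧ ∀ s ∈ Ioo a (t₀ + δ), IsUnitSpeedAt γ' s := by
  obtain ⟨g, hg0, hg⟩ := hδ (γ t₀)
  have hevγ : ∀ᶠ s in 𝓝 t₀, IsUnitSpeedAt γ s :=
    Filter.eventually_of_mem (isOpen_Ioo.mem_nhds ht₀) hγ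
  have hevg : ∀ᶠ s in 𝓝 0, IsUnitSpeedAt g s := by
    filter_upwards [Metric.ball_mem_nhds (0 : ℝ) hδ0] with s hs
    exact hg s (by simpa using hs)
  obtain ⟨σ, hσ, hA⟩ := eventually_eq_of_isUnitSpeedAt hevγ hevg hg0.symm
  -- The sign `σ` orients the new piece so that its germ at `t₀` is that of `γ`.
  set h : ℝ → M := fun s ↦ g (σ * s + -σ * t₀) with hh
  have hhs : ∀ s, |s - t₀| < δ → IsUnitSpeedAt h s := fun s hs ↦
    IsUnitSpeedAt.comp_affine hσ (hg _ (by
      rwa [show σ * s + -σ * t₀ = σ * (s - t₀) by ring, abs_mul, hσ, one_mul]))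
  have hγh : h =ᶠ[𝓝 t₀] γ := by
    have hsub : Filter.Tendsto (fun s : ℝ ↦ s - t₀) (𝓝 t₀) (𝓝 0) := by
      have : Continuous (fun s : ℝ ↦ s - t₀) := by fun_prop
      simpa using this.tendsto t₀
    filter_upwards [hsub.eventually hA] with s hs
    rw [add_sub_cancel] at hs
    rw [hs, hh]
    simp only
    congr 1
    ring
  refine ⟨fun s ↦ if s < t₀ then γ s else h s, fun s hs ↦ if_pos hs, fun s hs ↦ ?_⟩
  rcases lt_trichotomy s t₀ with hst | rfl | hst
  · refine (hγ s ⟨hs.1, hst.trans ht₀.2⟩).congr ?_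
    filter_upwards [Iio_mem_nhds hst] with r hr using if_pos hr
  · refine (hγ s ht₀).congr ?_
    filter_upwards [hγh] with r hr
    split_ifs
    · rfl
    · exact hr
  · refine (hhs s ?_).congr ?_
    · rw [abs_lt]
      constructor <;> linarith [hs.2]
    · filter_upwards [Ioi_mem_nhds hst] with r hr using if_neg (not_lt.2 (le_of_lt hr))

/-- A unit speed curve can be prolonged in both directions. -/
theorem exists_isUnitSpeedAt_extend {γ : ℝ → M} {R δ : ℝ} (hδ0 : 0 < δ) (hR : δ ≤ R)
    (hδ : ∀ p : M, ∃ γ : ℝ → M, γ 0 = p ∧ ∀ s, |s| < δ → IsUnitSpeedAt γ s)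
    (hγ : ∀ s ∈ Ioo (-R) R, IsUnitSpeedAt γ s) :
    ∃ γ' : ℝ → M, γ' =ᶠ[𝓝 0] γ ∧
      ∀ s ∈ Ioo (-(R + δ / 2)) (R + δ / 2), IsUnitSpeedAt γ' s := by
  -- Gluing at the interior point `R - δ / 2` a piece of length `δ` gains `δ / 2`. The left end is
  -- treated by reflecting, extending and reflecting back. As `δ ≤ R`, the gluing points stay away
  -- from `0`.
  obtain ⟨γ₁, he₁, h₁⟩ := exists_isUnitSpeedAt_extend_right (t₀ := R - δ / 2) hδ hγ
    ⟨by linarith, by linarith⟩ hδ0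
  obtain ⟨γ₂, he₂, h₂⟩ := exists_isUnitSpeedAt_extend_right (γ := fun s ↦ γ₁ (-1 * s + 0))
    (a := -(R + δ / 2)) (b := R) (t₀ := R - δ / 2) hδ
    (fun s hs ↦ IsUnitSpeedAt.comp_affine (by simp)
      (h₁ _ ⟨by linarith [hs.2], by linarith [hs.1]⟩)) ⟨by linarith, by linarith⟩ hδ0
  refine ⟨fun s ↦ γ₂ (-1 * s + 0), ?_, fun s hs ↦ IsUnitSpeedAt.comp_affine (by simp)
      (h₂ _ ⟨by linarith [hs.2], by linarith [hs.1]⟩)⟩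
  filter_upwards [Ioo_mem_nhds (a := -(R - δ / 2)) (b := R - δ / 2) (x := 0) (by linarith)
    (by linarith)] with s hs
  rw [he₂ (show -1 * s + 0 < R - δ / 2 by linarith [hs.1])]
  simp only
  rw [he₁ (show -1 * (-1 * s + 0) + 0 < R - δ / 2 by linarith [hs.2])]
  congr 1
  ring

/-- A compact one-dimensional Riemannian manifold carries a unit speed curve defined on the line. -/
theorem exists_forall_isUnitSpeedAt [T2Space M] [CompactSpace M] [Nonempty M] :
    ∃ γ : ℝ → M, ∀ t, IsUnitSpeedAt γ t := by
  obtain ⟨δ, hδ0, hδ⟩ := exists_isUnitSpeedAt_uniform (M := M)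
  obtain ⟨g, -, hg⟩ := hδ (Classical.arbitrary M)
  set R : ℕ → ℝ := fun n ↦ δ + n * (δ / 2) with hR
  have hRpos : ∀ n, δ ≤ R n := fun n ↦ le_add_of_nonneg_right (by positivity)
  have hex : ∀ n : ℕ, ∃ γ : ℝ → M, γ =ᶠ[𝓝 0] g ∧ ∀ s ∈ Ioo (-(R n)) (R n), IsUnitSpeedAt γ s := by
    intro n
    induction n with
    | zero =>
      refine ⟨g, Filter.EventuallyEq.rfl, fun s hs ↦ hg s (abs_lt.2 ?_)⟩
      simpa [hR] using hs
    | succ n ih =>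
      obtain ⟨γ, he, hγ⟩ := ih
      obtain ⟨γ', he', hγ'⟩ := exists_isUnitSpeedAt_extend hδ0 (hRpos n) hδ hγ
      have : R (n + 1) = R n + δ / 2 := by simp only [hR]; push_cast; ring
      exact ⟨γ', he'.trans he, by rwa [this]⟩
  choose γ he hγ using hex
  have hRmono : Monotone R := fun m n hmn ↦ by
    have : (m : ℝ) ≤ n := by exact_mod_cast hmn
    simp only [hR]
    gcongr
  have hN : ∀ s : ℝ, ∃ n, s ∈ Ioo (-(R n)) (R n) := by
    intro s
    obtain ⟨n, hn⟩ := exists_nat_gt (|s| / (δ / 2))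
    refine ⟨n, abs_lt.1 ?_⟩
    rw [div_lt_iff₀ (by positivity)] at hn
    simp only [hR]
    linarith
  choose N hN using hN
  -- All prolongations keep the germ of `g` at `0`, so uniqueness makes them compatible and the
  -- choice of `N s` is immaterial.
  have hagree_le : ∀ m n, m ≤ n → EqOn (γ m) (γ n) (Ioo (-(R m)) (R m)) := by
    intro m n hmn
    have hle := hRmono hmn
    exact eqOn_of_eventuallyEq_of_isUnitSpeedAt isOpen_Ioo isPreconnected_Ioo (hγ m)
      (fun s hs ↦ hγ n s ⟨by linarith [hs.1], by linarith [hs.2]⟩)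
      (t₀ := 0) ⟨by linarith [hRpos m], by linarith [hRpos m]⟩ ((he m).trans (he n).symm)
  have hagree : ∀ n s, s ∈ Ioo (-(R n)) (R n) → γ (N s) s = γ n s := by
    intro n s hs
    rcases le_total (N s) n with h | h
    · exact hagree_le _ _ h (hN s)
    · exact (hagree_le _ _ h hs).symm
  refine ⟨fun s ↦ γ (N s) s, fun t ↦ (hγ (N t) t (hN t)).congr ?_⟩
  filter_upwards [isOpen_Ioo.mem_nhds (hN t)] with s hs using hagree _ _ hs

end Extension

/-! ### Periodicity -/

section Periodicity

variable {M : Type*} [TopologicalSpace M] [ChartedSpace (EuclideanSpace ℝ (Fin 1)) M]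
  [RiemannianBundle (fun x : M ↦ TangentSpace (𝓡 1) x)] {γ : ℝ → M}

theorem continuous_of_isUnitSpeedAt (hγ : ∀ t, IsUnitSpeedAt γ t) : Continuous γ :=
  continuous_iff_continuousAt.2 fun t ↦ (hγ t).1.continuousAt

variable [IsManifold (𝓡 1) ∞ M] [IsContMDiffRiemannianBundle (𝓡 1) ∞ (EuclideanSpace ℝ (Fin 1))
    (fun x : M ↦ TangentSpace (𝓡 1) x)]

theorem isOpenMap_of_isUnitSpeedAt (hγ : ∀ t, IsUnitSpeedAt γ t) : IsOpenMap γ :=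
  isOpenMap_iff_nhds_le.2 fun _ ↦
    (map_nhds_eq_of_isUnitSpeedAt (Filter.Eventually.of_forall hγ)).ge

variable [T2Space M]

/-- The range is open. At a point `p` of its closure, a short unit speed curve `g` through `p` meets
`γ`; by uniqueness the two run together along all of `g`, so `γ` reaches `p`. -/
theorem surjective_of_isUnitSpeedAt [ConnectedSpace M]
    (hγ : ∀ t, IsUnitSpeedAt γ t) : Function.Surjective γ := by
  have hopen : IsOpen (range γ) := (isOpenMap_of_isUnitSpeedAt hγ).isOpen_range
  have hclosed : IsClosed (range γ) := by
    refine isClosed_of_closure_subset fun p hp ↦ ?_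
    obtain ⟨g, hg0, δ, hδ, hg⟩ := exists_isUnitSpeedAt_ball p
    have hevg : ∀ s, |s| < δ → ∀ᶠ r in 𝓝 s, IsUnitSpeedAt g r := by
      intro s hs
      have : IsOpen {r : ℝ | |r| < δ} := isOpen_lt continuous_abs continuous_const
      exact Filter.eventually_of_mem (this.mem_nhds hs) fun r hr ↦ hg r hr
    have himg : g '' Metric.ball 0 δ ∈ 𝓝 p := by
      rw [← hg0, ← map_nhds_eq_of_isUnitSpeedAt (hevg 0 (by simpa using hδ))]
      exact Filter.image_mem_map (Metric.ball_mem_nhds _ hδ)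
    obtain ⟨_, ⟨s, hs, rfl⟩, ⟨t, ht⟩⟩ := mem_closure_iff_nhds.1 hp _ himg
    rw [Metric.mem_ball, dist_zero_right, Real.norm_eq_abs] at hs
    obtain ⟨a, ha, hA⟩ := eventually_eq_of_isUnitSpeedAt (Filter.Eventually.of_forall hγ)
      (hevg s hs) ht
    have haa : a * a = 1 := by rw [← abs_mul_abs_self, ha, one_mul]
    have key := eqOn_of_eventuallyEq_of_isUnitSpeedAt (γ₁ := fun r ↦ γ (1 * r + t))
      (γ₂ := fun r ↦ g (a * r + s)) (U := (fun r ↦ a * r + s) ⁻¹' Ioo (-δ) δ) (t₀ := 0)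
      (isOpen_Ioo.preimage (by fun_prop))
      (by
        rcases eq_or_eq_neg_of_abs_eq ha with rfl | rfl
        · have : (fun r : ℝ ↦ 1 * r + s) ⁻¹' Ioo (-δ) δ = Ioo (-δ - s) (δ - s) := by
            ext r; simp only [mem_preimage, mem_Ioo]; constructor <;> rintro ⟨h, h'⟩ <;>
              constructor <;> linarith
          rw [this]; exact isPreconnected_Ioo
        · have : (fun r : ℝ ↦ -1 * r + s) ⁻¹' Ioo (-δ) δ = Ioo (s - δ) (s + δ) := by
            ext r; simp only [mem_preimage, mem_Ioo]; constructor <;> rintro ⟨h, h'⟩ <;>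
              constructor <;> linarith
          rw [this]; exact isPreconnected_Ioo)
      (fun r _ ↦ IsUnitSpeedAt.comp_affine (by simp) (hγ _))
      (fun r hr ↦ IsUnitSpeedAt.comp_affine ha (hg _ (abs_lt.2 hr)))
      (by simpa using abs_lt.1 hs)
      (by filter_upwards [hA] with r hr; rw [one_mul, add_comm, hr, add_comm])
    have h0 : a * (-a * s) + s = 0 := by linear_combination (-s) * haa
    -- This parameter solves `a * r + s = 0`, where `g` passes through `p`.
    have := key (x := -a * s) (by
      rw [mem_preimage, h0]; exact ⟨by linarith, hδ⟩)
    simp only [h0, hg0] at this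
    exact ⟨_, this⟩
  have := IsClopen.eq_univ ⟨hclosed, hopen⟩ (range_nonempty γ)
  exact range_eq_univ.1 this

/-- The germs at `a` and `b` agree up to a sign, and uniqueness makes this global. The sign `+` is
periodicity; the sign `-` makes `γ` symmetric about `(a + b) / 2`, contradicting local injectivity
there. -/
theorem periodic_of_eq (hγ : ∀ t, IsUnitSpeedAt γ t) {a b : ℝ}
    (hab : γ a = γ b) : Function.Periodic γ (b - a) := by
  have hev : ∀ t, ∀ᶠ s in 𝓝 t, IsUnitSpeedAt γ s := fun t ↦ Filter.Eventually.of_forall hγ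
  obtain ⟨σ, hσ, hA⟩ := eventually_eq_of_isUnitSpeedAt (hev a) (hev b) hab
  have key := eqOn_of_eventuallyEq_of_isUnitSpeedAt (γ₁ := fun r ↦ γ (1 * r + a))
      (γ₂ := fun r ↦ γ (σ * r + b)) (U := univ) (t₀ := 0) isOpen_univ isPreconnected_univ
      (fun r _ ↦ IsUnitSpeedAt.comp_affine (by simp) (hγ _))
      (fun r _ ↦ IsUnitSpeedAt.comp_affine hσ (hγ _)) (mem_univ _)
      (by filter_upwards [hA] with r hr; rw [one_mul, add_comm, hr, add_comm])
  have key' : ∀ r, γ (1 * r + a) = γ (σ * r + b) := fun r ↦ key (mem_univ r)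
  rcases eq_or_eq_neg_of_abs_eq hσ with rfl | rfl
  · intro t
    have := key' (t - a)
    rw [show 1 * (t - a) + a = t by ring, show 1 * (t - a) + b = t + (b - a) by ring] at this
    exact this.symm
  · exfalso
    obtain ⟨v, -, -, -, hv⟩ := exists_contMDiffAt_rightInverse (hev ((a + b) / 2))
    have hp : Filter.Tendsto (fun s : ℝ ↦ (a + b) / 2 + s) (𝓝[≠] 0) (𝓝 ((a + b) / 2)) := by
      have : Continuous (fun s : ℝ ↦ (a + b) / 2 + s) := by fun_prop
      have := this.tendsto 0
      simp only [add_zero] at this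
      exact this.mono_left nhdsWithin_le_nhds
    have hm : Filter.Tendsto (fun s : ℝ ↦ (a + b) / 2 - s) (𝓝[≠] 0) (𝓝 ((a + b) / 2)) := by
      have : Continuous (fun s : ℝ ↦ (a + b) / 2 - s) := by fun_prop
      have := this.tendsto 0
      simp only [sub_zero] at this
      exact this.mono_left nhdsWithin_le_nhds
    obtain ⟨s, hs1, hs2, hs0⟩ := ((hp.eventually hv).and
      ((hm.eventually hv).and self_mem_nhdsWithin)).exists
    have := key' ((b - a) / 2 + s)
    rw [show 1 * ((b - a) / 2 + s) + a = (a + b) / 2 + s by ring,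
      show -1 * ((b - a) / 2 + s) + b = (a + b) / 2 - s by ring] at this
    rw [this, hs2] at hs1
    exact hs0 (show s = 0 by linarith)

/-- An injective `γ` would be a homeomorphism from the line onto a compact space. -/
theorem not_injective_of_isUnitSpeedAt [ConnectedSpace M] [CompactSpace M]
    (hγ : ∀ t, IsUnitSpeedAt γ t) :
    ¬ Function.Injective γ := by
  intro hinj
  have e := (Equiv.ofBijective γ ⟨hinj, surjective_of_isUnitSpeedAt hγ⟩).toHomeomorphOfContinuousOpen
    (continuous_of_isUnitSpeedAt hγ) (isOpenMap_of_isUnitSpeedAt hγ)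
  have : CompactSpace ℝ := e.symm.compactSpace
  exact noncompact_univ ℝ isCompact_univ

/-- A unit speed curve on a compact connected manifold is periodic, and injective modulo its
period. -/
theorem exists_period_of_isUnitSpeedAt [ConnectedSpace M] [CompactSpace M]
    (hγ : ∀ t, IsUnitSpeedAt γ t) :
    ∃ L : ℝ, 0 < L ∧ Function.Periodic γ L ∧ ∀ s t : ℝ, γ s = γ t → (s : AddCircle L) = t := by
  let P : AddSubgroup ℝ :=
    { carrier := {c | Function.Periodic γ c}
      add_mem' := fun ha hb ↦ ha.add_period hb
      zero_mem' := fun t ↦ by simp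
      neg_mem' := fun ha ↦ ha.neg }
  have hmem : ∀ c, c ∈ P ↔ Function.Periodic γ c := fun c ↦ Iff.rfl
  -- Arbitrarily small positive periods would contradict local injectivity at `0`; a subgroup of the
  -- line that is not dense is cyclic.
  have hnd : ¬ Dense (P : Set ℝ) := by
    intro hd
    obtain ⟨v, -, -, -, hv⟩ := exists_contMDiffAt_rightInverse
      (Filter.Eventually.of_forall hγ : ∀ᶠ s in 𝓝 (0 : ℝ), IsUnitSpeedAt γ s)
    obtain ⟨δ, hδ, hball⟩ := Metric.eventually_nhds_iff_ball.1 hv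
    obtain ⟨c, hcP, hc⟩ := hd.exists_mem_open (isOpen_Ioo (a := 0) (b := δ)) ⟨δ / 2, by
      constructor <;> linarith⟩
    have h1 := hball c (by rw [Metric.mem_ball, dist_zero_right, Real.norm_eq_abs, abs_of_pos hc.1]
                           exact hc.2)
    have h2 := hball 0 (Metric.mem_ball_self hδ)
    have h3 : γ (0 + c) = γ 0 := (hmem c).1 hcP 0
    rw [zero_add] at h3
    rw [h3, h2] at h1
    linarith [hc.1]
  obtain ⟨c, hc⟩ := P.dense_or_cyclic.resolve_left hnd
  have hc0 : c ≠ 0 := by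
    rintro rfl
    refine not_injective_of_isUnitSpeedAt hγ fun s t hst ↦ ?_
    have : t - s ∈ P := periodic_of_eq hγ hst
    rw [hc] at this
    simp only [AddSubgroup.closure_singleton_zero, AddSubgroup.mem_bot] at this
    linarith
  have hP : P = AddSubgroup.zmultiples |c| := by
    rw [hc, ← AddSubgroup.zmultiples_eq_closure]
    rcases abs_choice c with h | h <;> rw [h]
    exact AddSubgroup.zmultiples_neg.symm
  refine ⟨|c|, abs_pos.2 hc0, ?_, fun s t hst ↦ ?_⟩
  · rw [← hmem, hP]
    exact AddSubgroup.mem_zmultiples _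
  · rw [QuotientAddGroup.eq, ← hP, hmem, neg_add_eq_sub]
    exact periodic_of_eq hγ hst

end Periodicity

/-! ### The projection onto the flat circle -/

section Projection

variable (L : ℝ) [hL : Fact (0 < L)]

theorem flatCircleChart_target (a : ℝ) : (flatCircleChart L a).target = Ioo a (a + L) := rfl

/-- Near `t` the projection is the inverse of the chart with range `(t - L / 2, t + L / 2)`. -/
theorem contMDiff_coe_addCircle :
    ContMDiff 𝓘(ℝ, ℝ) 𝓘(ℝ, ℝ) ∞ (fun t : ℝ ↦ (t : AddCircle L)) := by
  intro t
  have h0 : 0 < L := hL.out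
  have hmem : flatCircleChart L (t - L / 2) ∈
      IsManifold.maximalAtlas 𝓘(ℝ, ℝ) ∞ (AddCircle L) :=
    IsManifold.subset_maximalAtlas (mem_range_self _)
  refine (contMDiffOn_symm_of_mem_maximalAtlas hmem).contMDiffAt ?_
  rw [flatCircleChart_target]
  exact Ioo_mem_nhds (by linarith) (by linarith)

/-- In the tangent coordinates of the flat circle, the differential of the projection is the
identity. -/
theorem mfderiv_coe_addCircle (t : ℝ) :
    mfderiv 𝓘(ℝ, ℝ) 𝓘(ℝ, ℝ) (fun t : ℝ ↦ (t : AddCircle L)) t (1 : ℝ) = (1 : ℝ) := by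
  have h0 : 0 < L := hL.out
  set q : ℝ → AddCircle L := fun t ↦ (t : AddCircle L) with hq
  -- The preferred chart at the class of `t` is centred at the representative `t₁ ∈ [0, L)`, where
  -- the projection reads as the identity; invariance under translation by the period `t₁ - t`
  -- carries this back to `t`.
  set t₁ : ℝ := (AddCircle.equivIco L 0 (t : AddCircle L) : ℝ) with ht₁
  have hq₁ : q t₁ = q t := AddCircle.coe_equivIco
  have hdiff : ∀ s, MDifferentiableAt 𝓘(ℝ, ℝ) 𝓘(ℝ, ℝ) q s := fun s ↦
    (contMDiff_coe_addCircle L).mdifferentiableAt (by simp)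
  have htrans : (fun s ↦ q (s + (t₁ - t))) = q := by
    funext s
    have : ((t₁ - t : ℝ) : AddCircle L) = 0 := by
      rw [AddCircle.coe_sub]; exact sub_eq_zero.2 hq₁
    simp only [hq, AddCircle.coe_add, this, add_zero]
  have hshift : HasMFDerivAt 𝓘(ℝ, ℝ) 𝓘(ℝ, ℝ) (fun s : ℝ ↦ s + (t₁ - t)) t
      (ContinuousLinearMap.id ℝ ℝ) :=
    ((hasFDerivAt_id t).add_const _).hasMFDerivAt
  have hbase : ∀ x : AddCircle L, x = q t₁ → ∀ D : ℝ →L[ℝ] ℝ,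
      HasMFDerivAt 𝓘(ℝ, ℝ) 𝓘(ℝ, ℝ) q t₁ D → D 1 = 1 := by
    rintro _ rfl D hD
    have hD2 := hD.2
    have hch : ∀ᶠ s in 𝓝 t₁, writtenInExtChartAt 𝓘(ℝ, ℝ) 𝓘(ℝ, ℝ) t₁ q s = s := by
      have hIoo : Ioo (t₁ - L / 2) (t₁ - L / 2 + L) ∈ 𝓝 t₁ :=
        Ioo_mem_nhds (by linarith) (by linarith)
      filter_upwards [hIoo] with s hs
      have hc : chartAt ℝ (q t₁) = flatCircleChart L (t₁ - L / 2) := by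
        rw [hq₁]; rfl
      have := (flatCircleChart L (t₁ - L / 2)).right_inv hs
      simp only [writtenInExtChartAt, mfld_simps]
      rw [hc]
      exact this
    rw [extChartAt_model_space_eq_id, PartialEquiv.refl_coe, id, modelWithCornersSelf_coe,
      range_id] at hD2
    have hD3 : HasFDerivAt (writtenInExtChartAt 𝓘(ℝ, ℝ) 𝓘(ℝ, ℝ) t₁ q : ℝ → ℝ) D t₁ :=
      hasFDerivWithinAt_univ.1 hD2
    have := hD3.congr_of_eventuallyEq (f₁ := id) (hch.mono fun s hs ↦ hs.symm)
    rw [this.unique (hasFDerivAt_id t₁)]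
    rfl
  have h1 : HasMFDerivAt 𝓘(ℝ, ℝ) 𝓘(ℝ, ℝ) q t₁ (mfderiv 𝓘(ℝ, ℝ) 𝓘(ℝ, ℝ) q t₁) :=
    (hdiff t₁).hasMFDerivAt
  have ht : t + (t₁ - t) = t₁ := by ring
  have h2 : HasMFDerivAt 𝓘(ℝ, ℝ) 𝓘(ℝ, ℝ) q (t + (t₁ - t))
      (mfderiv 𝓘(ℝ, ℝ) 𝓘(ℝ, ℝ) q (t + (t₁ - t))) := (hdiff _).hasMFDerivAt
  have h3 := h2.comp t hshift
  have h4 : q ∘ (fun s ↦ s + (t₁ - t)) = q := htrans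
  rw [h4] at h3
  have h5 := h3.mfderiv
  rw [h5]
  have h6 := hbase _ rfl _ h1
  have key : ∀ r : ℝ, r = t₁ → (show ℝ →L[ℝ] ℝ from mfderiv 𝓘(ℝ, ℝ) 𝓘(ℝ, ℝ) q r) 1 = 1 := by
    rintro _ rfl
    exact h6
  exact key _ ht

end Projection

/-! ### Arc length parametrization by the circle -/

section Circle

variable {M : Type*} [TopologicalSpace M] [ChartedSpace (EuclideanSpace ℝ (Fin 1)) M]
  [RiemannianBundle (fun x : M ↦ TangentSpace (𝓡 1) x)] {L : ℝ} [hL : Fact (0 < L)]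

/-- A diffeomorphism from the flat circle with unit speed is a Riemannian isometry. -/
theorem isRiemannianIsometry_of_isUnitSpeedAt (Φ : AddCircle L ≃ₘ^∞⟮𝓘(ℝ, ℝ), 𝓡 1⟯ M)
    (h : ∀ t : ℝ, IsUnitSpeedAt (fun t : ℝ ↦ Φ t) t) : IsRiemannianIsometry Φ := by
  intro x v w
  obtain ⟨t, rfl⟩ := QuotientAddGroup.mk_surjective x
  have hsp : ‖mfderiv 𝓘(ℝ, ℝ) (𝓡 1) (fun t : ℝ ↦ Φ t) t (1 : ℝ)‖ = 1 := (h t).2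
  have hΦ : MDifferentiableAt 𝓘(ℝ, ℝ) (𝓡 1) Φ (t : AddCircle L) :=
    Φ.contMDiff.mdifferentiableAt (by simp)
  have hq : MDifferentiableAt 𝓘(ℝ, ℝ) 𝓘(ℝ, ℝ) (fun t : ℝ ↦ (t : AddCircle L)) t :=
    (contMDiff_coe_addCircle L).mdifferentiableAt (by simp)
  have hcomp := mfderiv_comp t hΦ hq
  set X : TangentSpace (𝓡 1) (Φ (t : AddCircle L)) :=
    mfderiv 𝓘(ℝ, ℝ) (𝓡 1) Φ (t : AddCircle L) (1 : ℝ) with hX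
  have hX1 : ‖X‖ = 1 := by
    rw [← hsp]
    have : mfderiv 𝓘(ℝ, ℝ) (𝓡 1) (fun t : ℝ ↦ Φ t) t (1 : ℝ) = X := by
      change mfderiv 𝓘(ℝ, ℝ) (𝓡 1) (Φ ∘ fun t : ℝ ↦ (t : AddCircle L)) t (1 : ℝ) = X
      rw [hcomp, hX]
      change mfderiv 𝓘(ℝ, ℝ) (𝓡 1) Φ (t : AddCircle L)
        (mfderiv 𝓘(ℝ, ℝ) 𝓘(ℝ, ℝ) (fun t : ℝ ↦ (t : AddCircle L)) t (1 : ℝ)) = _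
      rw [mfderiv_coe_addCircle]
    rw [this]
  -- The source tangent space is a line, so the unit length of the image of `1` determines the
  -- pulled back metric.
  have hsmul : ∀ u : ℝ, mfderiv 𝓘(ℝ, ℝ) (𝓡 1) Φ (t : AddCircle L) u = u • X := by
    intro u
    have := (mfderiv 𝓘(ℝ, ℝ) (𝓡 1) Φ (t : AddCircle L)).map_smul u (1 : ℝ)
    rw [hX, ← this]
    congr 1
    exact (mul_one u).symm
  have key : ∀ a b : ℝ, (inner ℝ (mfderiv 𝓘(ℝ, ℝ) (𝓡 1) Φ (t : AddCircle L) a)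
      (mfderiv 𝓘(ℝ, ℝ) (𝓡 1) Φ (t : AddCircle L) b) : ℝ) = inner ℝ a b := by
    intro a b
    rw [hsmul, hsmul, real_inner_smul_left, real_inner_smul_right, real_inner_self_eq_norm_sq, hX1]
    simp only [RCLike.inner_apply, conj_trivial]
    ring
  exact key v w

variable [IsManifold (𝓡 1) ∞ M] [IsContMDiffRiemannianBundle (𝓡 1) ∞ (EuclideanSpace ℝ (Fin 1))
    (fun x : M ↦ TangentSpace (𝓡 1) x)]

/-- A periodic unit speed curve which is injective modulo its period is a parametrization by the
flat circle. -/
theorem exists_diffeomorph_of_isUnitSpeedAt {γ : ℝ → M} (hγ : ∀ t, IsUnitSpeedAt γ t)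
    (hper : Function.Periodic γ L) (hinj : ∀ s t : ℝ, γ s = γ t → (s : AddCircle L) = t)
    (hsurj : Function.Surjective γ) :
    ∃ Φ : AddCircle L ≃ₘ^∞⟮𝓘(ℝ, ℝ), 𝓡 1⟯ M, ∀ t : ℝ, Φ t = γ t := by
  have hbij : Function.Bijective hper.lift := by
    constructor
    · intro x y hxy
      obtain ⟨s, rfl⟩ := QuotientAddGroup.mk_surjective x
      obtain ⟨t, rfl⟩ := QuotientAddGroup.mk_surjective y
      exact hinj s t hxy
    · intro p
      obtain ⟨t, rfl⟩ := hsurj p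
      exact ⟨t, rfl⟩
  refine ⟨{ toEquiv := Equiv.ofBijective _ hbij
            contMDiff_toFun := ?_
            contMDiff_invFun := ?_ }, fun t ↦ rfl⟩
  · intro x
    have hγs : ContMDiff 𝓘(ℝ, ℝ) (𝓡 1) ∞ γ := fun t ↦ (hγ t).1
    have hch := contMDiffOn_chart (I := 𝓘(ℝ, ℝ)) (n := ∞) (H := ℝ) (x := x)
    have hx := (chartAt ℝ x).open_source.mem_nhds (mem_chart_source ℝ x)
    refine (hγs.contMDiffAt.comp x (hch.contMDiffAt hx)).congr_of_eventuallyEq ?_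
    filter_upwards [hx] with y hy
    have := coe_flatCircleChart L _ hy
    change hper.lift y = γ (chartAt ℝ x y)
    conv_lhs => rw [← this]
    rfl
  · intro p
    obtain ⟨t, rfl⟩ := hsurj p
    obtain ⟨v, hv, hvs, hvr, -⟩ := exists_contMDiffAt_rightInverse
      (Filter.Eventually.of_forall hγ : ∀ᶠ s in 𝓝 t, IsUnitSpeedAt γ s)
    refine ((contMDiff_coe_addCircle L).contMDiffAt.comp (γ t) hvs).congr_of_eventuallyEq ?_
    filter_upwards [hvr] with x hx
    refine (Equiv.symm_apply_eq _).2 ?_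
    exact hx.symm

/-- A compact connected one-dimensional Riemannian manifold is parametrized by arc length by a
circle. -/
theorem exists_diffeomorph_isUnitSpeedAt [T2Space M] [CompactSpace M] [ConnectedSpace M] :
    ∃ (L : ℝ) (_ : Fact (0 < L)) (Φ : AddCircle L ≃ₘ^∞⟮𝓘(ℝ, ℝ), 𝓡 1⟯ M),
      ∀ t : ℝ, IsUnitSpeedAt (fun t : ℝ ↦ Φ t) t := by
  obtain ⟨γ, hγ⟩ := exists_forall_isUnitSpeedAt (M := M)
  obtain ⟨L, hL, hper, hinj⟩ := exists_period_of_isUnitSpeedAt hγ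
  have hF : Fact (0 < L) := ⟨hL⟩
  obtain ⟨Φ, hΦ⟩ := exists_diffeomorph_of_isUnitSpeedAt hγ hper hinj
    (surjective_of_isUnitSpeedAt hγ)
  exact ⟨L, hF, Φ, by simpa only [hΦ] using hγ⟩

end Circle

/-! ### The Riemannian volume in dimension one -/

/-- A measure on a compact space is the supremum of its restrictions to the members of an open
cover. -/
theorem iSup_restrict_eq_of_isOpen_cover {X ι : Type*} [TopologicalSpace X] [CompactSpace X]
    [MeasurableSpace X] [OpensMeasurableSpace X] (μ : Measure X) {U : ι → Set X}
    (hU : ∀ i, IsOpen (U i)) (hcover : ⋃ i, U i = univ) : ⨆ i, μ.restrict (U i) = μ := by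
  refine le_antisymm (iSup_le fun i ↦ Measure.restrict_le_self) ?_
  set ν := ⨆ i, μ.restrict (U i) with hν
  obtain ⟨t, ht⟩ := isCompact_univ.elim_finite_subcover U hU hcover.ge
  have key : ∀ t : Finset ι, μ.restrict (⋃ i ∈ t, U i) ≤ ν := by
    classical
    intro t
    induction t using Finset.induction_on with
    | empty => simpa using Measure.zero_le ν
    | insert i t hi ih =>
      rw [Finset.set_biUnion_insert]
      refine Measure.le_intro fun s hs _ ↦ ?_
      -- A supremum of measures is not computed setwise, so `s` is cut along `U i`: one piece is
      -- bounded by the new member, the other by induction.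
      have h1 : s ∩ (U i ∪ ⋃ j ∈ t, U j) ⊆
          (s ∩ U i) ∪ ((s \ U i) ∩ ⋃ j ∈ t, U j) := by
        rintro x ⟨hxs, hx⟩
        by_cases hxi : x ∈ U i
        · exact Or.inl ⟨hxs, hxi⟩
        · exact Or.inr ⟨⟨hxs, hxi⟩, hx.resolve_left hxi⟩
      have hm := (hU i).measurableSet
      have h2 : μ.restrict (U i) ≤ ν := le_iSup (fun i ↦ μ.restrict (U i)) i
      have h3 := h2 (s ∩ U i)
      have h4 := ih (s \ U i)
      rw [Measure.restrict_apply (hs.inter hm), inter_assoc, inter_self] at h3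
      rw [Measure.restrict_apply (hs.diff hm)] at h4
      rw [Measure.restrict_apply hs]
      calc _ ≤ μ (s ∩ U i) + μ ((s \ U i) ∩ ⋃ j ∈ t, U j) :=
            (measure_mono h1).trans (measure_union_le _ _)
        _ ≤ ν (s ∩ U i) + ν (s \ U i) := add_le_add h3 h4
        _ = ν s := measure_inter_add_sdiff s hm
  have := key t
  rwa [univ_subset_iff.1 ht, Measure.restrict_univ] at this

section Volume

variable {M : Type*} [TopologicalSpace M] [ChartedSpace (EuclideanSpace ℝ (Fin 1)) M]
  [RiemannianBundle (fun x : M ↦ TangentSpace (𝓡 1) x)] [IsManifold (𝓡 1) ∞ M]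

/-- The Riemannian density of a chart is the speed of the inverse of the chart. -/
theorem volumeDensity_lineIso (p : M) {r : ℝ} (hr : r ∈ (lineChart p).target) :
    volumeDensity 1 p (lineIso r) = speed (lineChart p).symm r := by
  have hmem := (mem_lineChart_target p r).1 hr
  have h1 : MDifferentiableAt 𝓘(ℝ, EuclideanSpace ℝ (Fin 1)) (𝓡 1) (extChartAt (𝓡 1) p).symm
      (lineIso r) :=
    ((contMDiffOn_extChartAt_symm (n := ∞) p).contMDiffAt
      ((isOpen_extChartAt_target p).mem_nhds hmem)).mdifferentiableAt (by simp)
  have h2 : HasMFDerivAt 𝓘(ℝ, ℝ) 𝓘(ℝ, EuclideanSpace ℝ (Fin 1)) lineIso r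
      (lineIso.toContinuousLinearEquiv : ℝ →L[ℝ] EuclideanSpace ℝ (Fin 1)) :=
    lineIso.toContinuousLinearEquiv.hasFDerivAt.hasMFDerivAt
  have h3 := (h1.hasMFDerivAt.comp r h2).mfderiv
  have h4 : mfderiv 𝓘(ℝ, ℝ) (𝓡 1) (lineChart p).symm r (1 : ℝ) =
      coordVector 1 p 0 (lineIso r) :=
    congrArg (fun D : ℝ →L[ℝ] EuclideanSpace ℝ (Fin 1) ↦ D 1) h3
  have h5 : speed (lineChart p).symm r = ‖coordVector 1 p 0 (lineIso r)‖ :=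
    congrArg (fun v : TangentSpace (𝓡 1) ((extChartAt (𝓡 1) p).symm (lineIso r)) ↦ ‖v‖) h4
  rw [h5, volumeDensity, Matrix.det_fin_one, metricMatrix, Matrix.of_apply,
    real_inner_self_eq_norm_sq, Real.sqrt_sq (norm_nonneg _)]

variable [MeasurableSpace M] [BorelSpace M]

/-- The isometry `lineIso` preserves Lebesgue measure and turns the density into the speed. The
inverse chart is controlled only on its target, whose complement is null. -/
theorem chartVolume_apply (p : M) {A : Set M} (hA : MeasurableSet A) :
    chartVolume 1 p A = ∫⁻ r in (lineChart p).target ∩ (lineChart p).symm ⁻¹' A,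
      ENNReal.ofReal (speed (lineChart p).symm r) := by
  have hT : IsOpen (extChartAt (𝓡 1) p).target := isOpen_extChartAt_target p
  have hc : ContinuousOn (extChartAt (𝓡 1) p).symm (extChartAt (𝓡 1) p).target :=
    continuousOn_extChartAt_symm p
  have hB : MeasurableSet ((extChartAt (𝓡 1) p).target ∩ (extChartAt (𝓡 1) p).symm ⁻¹' A) := by
    have h1 := hT.measurableSet.subtype_image
      ((continuousOn_iff_continuous_domRestrict.1 hc).measurable hA)
    convert h1 using 1
    ext y
    simp [and_comm]
  have hB' : MeasurableSet ((lineChart p).target ∩ (lineChart p).symm ⁻¹' A) := by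
    have := lineIso.continuous.measurable hB
    convert this using 1
    ext r
    simp [mem_lineChart_target, lineChart_symm_apply]
  have hae : AEMeasurable (extChartAt (𝓡 1) p).symm
      ((volume.restrict (extChartAt (𝓡 1) p).target).withDensity
        fun y ↦ ENNReal.ofReal (volumeDensity 1 p y)) :=
    (hc.aemeasurable hT.measurableSet).mono_ac (withDensity_absolutelyContinuous _ _)
  rw [chartVolume, Measure.map_apply_of_aemeasurable hae hA]
  set ν := (volume.restrict (extChartAt (𝓡 1) p).target).withDensity
        fun y ↦ ENNReal.ofReal (volumeDensity 1 p y)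
  have hnull : ν (extChartAt (𝓡 1) p).targetᶜ = 0 := by
    refine withDensity_absolutelyContinuous _ _ ?_
    rw [Measure.restrict_apply hT.measurableSet.compl, compl_inter_self, measure_empty]
  rw [← measure_inter_conull hnull, inter_comm, withDensity_apply _ hB,
    Measure.restrict_restrict hB, inter_right_comm, inter_self,
    ← lineIso.measurePreserving.setLIntegral_comp_preimage_emb
      lineIso.toHomeomorph.measurableEmbedding]
  have : lineIso ⁻¹' ((extChartAt (𝓡 1) p).target ∩ (extChartAt (𝓡 1) p).symm ⁻¹' A) =
      (lineChart p).target ∩ (lineChart p).symm ⁻¹' A := by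
    ext r
    simp [mem_lineChart_target, lineChart_symm_apply]
  rw [this]
  refine setLIntegral_congr_fun hB' fun r hr ↦ ?_
  rw [volumeDensity_lineIso p hr.1]

variable {L : ℝ} {γ : ℝ → M}

/-- In a chart, the Riemannian volume is the image of the length under an arc length
parametrization. -/
theorem chartVolume_eq_restrict_map (hγ : ∀ t, IsUnitSpeedAt γ t) (hinj : InjOn γ (Ioc 0 L))
    (himg : γ '' Ioc 0 L = univ) (p : M) :
    chartVolume 1 p = ((volume.restrict (Ioc 0 L)).map γ).restrict (lineChart p).source := by
  have hcont := continuous_of_isUnitSpeedAt hγ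
  have hopen := (lineChart p).open_source
  refine Measure.ext fun A hA ↦ ?_
  set S : Set ℝ := Ioc 0 L ∩ γ ⁻¹' ((lineChart p).source ∩ A) with hS
  have hSm : MeasurableSet S :=
    measurableSet_Ioc.inter (hcont.measurable (hopen.measurableSet.inter hA))
  rw [Measure.restrict_apply hA, Measure.map_apply hcont.measurable (hA.inter hopen.measurableSet),
    Measure.restrict_apply (hcont.measurable (hA.inter hopen.measurableSet)),
    inter_comm _ (Ioc 0 L), inter_comm A, ← hS, chartVolume_apply p hA]
  have himgS : (lineChart p).target ∩ (lineChart p).symm ⁻¹' A = (lineChart p ∘ γ) '' S := by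
    ext r
    constructor
    · rintro ⟨hr, hrA⟩
      obtain ⟨t, ht, htr⟩ : (lineChart p).symm r ∈ γ '' Ioc 0 L := himg ▸ mem_univ _
      refine ⟨t, ⟨ht, ?_, ?_⟩, ?_⟩
      · rw [htr]; exact (lineChart p).map_target hr
      · rw [htr]; exact hrA
      · rw [Function.comp, htr, (lineChart p).right_inv hr]
    · rintro ⟨t, ⟨ht, hts, htA⟩, rfl⟩
      refine ⟨(lineChart p).map_source hts, ?_⟩
      rw [mem_preimage, Function.comp, (lineChart p).left_inv hts]
      exact htA
  have hder : ∀ t ∈ S, HasDerivAt (lineChart p ∘ γ) (deriv (lineChart p ∘ γ) t) t := by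
    intro t ht
    have h1 := ((contMDiffOn_lineChart p).contMDiffAt (hopen.mem_nhds ht.2.1)).comp t (hγ t).1
    exact ((contMDiffAt_iff_contDiffAt.1 h1).differentiableAt (by simp)).hasDerivAt
  have hinjS : InjOn (lineChart p ∘ γ) S := by
    intro s hs t ht hst
    exact hinj hs.1 ht.1 ((lineChart p).injOn hs.2.1 ht.2.1 hst)
  -- Change of variables by `lineChart p ∘ γ`: Jacobian times density is the speed of `γ`, namely
  -- `1`.
  rw [himgS, lintegral_image_eq_lintegral_abs_deriv_mul hSm
    (fun t ht ↦ (hder t ht).hasDerivWithinAt) hinjS, ← setLIntegral_one]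
  refine setLIntegral_congr_fun hSm fun t ht ↦ ?_
  rw [← ENNReal.ofReal_mul (abs_nonneg _)]
  have hsm : MDifferentiableAt 𝓘(ℝ, ℝ) (𝓡 1) (lineChart p).symm ((lineChart p ∘ γ) t) :=
    ((contMDiffOn_lineChart_symm p).contMDiffAt ((lineChart p).open_target.mem_nhds
      ((lineChart p).map_source ht.2.1))).mdifferentiableAt (by simp)
  have hev : (lineChart p).symm ∘ lineChart p ∘ γ =ᶠ[𝓝 t] γ := by
    filter_upwards [hcont.continuousAt (hopen.mem_nhds ht.2.1)] with s hs
      using (lineChart p).left_inv hs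
  rw [← speed_comp hsm (hder t ht), hev.speed_eq, (hγ t).2, ENNReal.ofReal_one]

/-- The Riemannian volume is the image of the length under an arc length parametrization. -/
theorem riemannianVolume_eq_map [CompactSpace M] (hγ : ∀ t, IsUnitSpeedAt γ t)
    (hinj : InjOn γ (Ioc 0 L)) (himg : γ '' Ioc 0 L = univ) :
    riemannianVolume 1 M = (volume.restrict (Ioc 0 L)).map γ := by
  rw [riemannianVolume]
  simp only [chartVolume_eq_restrict_map hγ hinj himg]
  exact iSup_restrict_eq_of_isOpen_cover _ (fun p ↦ (lineChart p).open_source)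
    (eq_univ_of_forall fun p ↦ mem_iUnion.2 ⟨p, mem_lineChart_source p⟩)

end Volume

/-! ### The Laplace-Beltrami operator in dimension one -/

section Laplacian

variable {M : Type*} [TopologicalSpace M] [ChartedSpace (EuclideanSpace ℝ (Fin 1)) M]
  [RiemannianBundle (fun x : M ↦ TangentSpace (𝓡 1) x)]

theorem fderiv_lineIso_single {F : Type*} [NormedAddCommGroup F] [NormedSpace ℝ F]
    (G : EuclideanSpace ℝ (Fin 1) → F) (r : ℝ) :
    fderiv ℝ G (lineIso r) (EuclideanSpace.single 0 1) = deriv (fun s ↦ G (lineIso s)) r := by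
  have := lineIso.toContinuousLinearEquiv.comp_right_fderiv (f := G) (x := r)
  have h2 := congrArg (fun D : ℝ →L[ℝ] F ↦ D 1) this
  exact h2.symm

/-- With one coordinate, `√g · g⁻¹ = (√g)⁻¹`; the convention `0⁻¹ = 0` covers every `y`, also off
the chart. -/
theorem volumeDensity_mul_inv (p : M) (y : EuclideanSpace ℝ (Fin 1)) :
    volumeDensity 1 p y * (metricMatrix 1 p y)⁻¹ 0 0 = (volumeDensity 1 p y)⁻¹ := by
  have h1 : (metricMatrix 1 p y) 0 0 = volumeDensity 1 p y ^ 2 := by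
    rw [volumeDensity, Matrix.det_fin_one, Real.sq_sqrt]
    exact real_inner_self_nonneg (x := coordVector 1 p 0 y)
  have h2 : (metricMatrix 1 p y)⁻¹ 0 0 = ((metricMatrix 1 p y) 0 0)⁻¹ := by
    rw [Matrix.inv_subsingleton, Matrix.diagonal_apply_eq, Ring.inverse_eq_inv']
  rw [h2, h1]
  rcases eq_or_ne (volumeDensity 1 p y) 0 with h | h
  · simp [h]
  · field_simp

variable [IsManifold (𝓡 1) ∞ M]

theorem laplaceBeltrami_eq_deriv (f : M → ℂ) (p : M) :
    laplaceBeltrami 1 f p = (speed (lineChart p).symm (lineChart p p))⁻¹ •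
      deriv (fun r ↦ (speed (lineChart p).symm r)⁻¹ • deriv (f ∘ (lineChart p).symm) r)
        (lineChart p p) := by
  have h0 : extChartAt (𝓡 1) p p = lineIso (lineChart p p) := by
    rw [lineChart_apply, LinearIsometryEquiv.apply_symm_apply]
  have hmem : lineChart p p ∈ (lineChart p).target :=
    (lineChart p).map_source (mem_lineChart_source p)
  rw [laplaceBeltrami, h0, volumeDensity_lineIso p hmem]
  simp only [Fin.sum_univ_one, volumeDensity_mul_inv]
  rw [fderiv_lineIso_single]
  congr 1
  refine Filter.EventuallyEq.deriv_eq ?_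
  filter_upwards [(lineChart p).open_target.mem_nhds hmem] with r hr
  rw [volumeDensity_lineIso p hr, fderiv_lineIso_single]
  rfl

variable [IsContMDiffRiemannianBundle (𝓡 1) ∞ (EuclideanSpace ℝ (Fin 1))
    (fun x : M ↦ TangentSpace (𝓡 1) x)]

/-- Along a unit speed curve, the Laplace-Beltrami operator is the second derivative. -/
theorem laplaceBeltrami_eq_deriv_deriv {f : M → ℂ} (hf : ContMDiff (𝓡 1) 𝓘(ℝ, ℂ) ∞ f)
    {γ : ℝ → M} (hγ : ∀ t, IsUnitSpeedAt γ t) (t : ℝ) :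
    laplaceBeltrami 1 f (γ t) = deriv (deriv (f ∘ γ)) t := by
  set p := γ t with hp
  set c := lineChart p with hc
  set ρ := speed c.symm with hρ
  set F := f ∘ c.symm with hF
  have hcont : Continuous γ := continuous_of_isUnitSpeedAt hγ
  have hsrc : ∀ᶠ s in 𝓝 t, γ s ∈ c.source :=
    hcont.continuousAt (c.open_source.mem_nhds (mem_lineChart_source p))
  have hρsm : ContDiffOn ℝ ∞ ρ c.target := contDiffOn_speed_lineChart_symm p
  have hρpos : ∀ r ∈ c.target, 0 < ρ r := fun r hr ↦ speed_lineChart_symm_pos p hr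
  have hFsm : ContDiffOn ℝ ∞ F c.target :=
    contMDiffOn_iff_contDiffOn.1 (hf.comp_contMDiffOn (contMDiffOn_lineChart_symm p))
  set ψ := c ∘ γ with hψ
  have hψsm : ∀ s, γ s ∈ c.source → ContDiffAt ℝ ∞ ψ s := fun s hs ↦
    contMDiffAt_iff_contDiffAt.1
      (((contMDiffOn_lineChart p).contMDiffAt (c.open_source.mem_nhds hs)).comp s (hγ s).1)
  have hψtar : ∀ s, γ s ∈ c.source → ψ s ∈ c.target := fun s hs ↦ c.map_source hs
  have hψd : ∀ s, γ s ∈ c.source → HasDerivAt ψ (deriv ψ s) s := fun s hs ↦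
    ((hψsm s hs).differentiableAt (by simp)).hasDerivAt
  have hψρ : ∀ s, γ s ∈ c.source → |deriv ψ s * ρ (ψ s)| = 1 := by
    intro s hs
    have hd : MDifferentiableAt 𝓘(ℝ, ℝ) (𝓡 1) c.symm (ψ s) :=
      ((contMDiffOn_lineChart_symm p).contMDiffAt
        (c.open_target.mem_nhds (hψtar s hs))).mdifferentiableAt (by simp)
    have hev : c.symm ∘ ψ =ᶠ[𝓝 s] γ := by
      filter_upwards [hcont.continuousAt (c.open_source.mem_nhds hs)] with r hr
        using c.left_inv hr
    rw [abs_mul, abs_of_pos (hρpos _ (hψtar s hs)), ← speed_comp hd (hψd s hs), hev.speed_eq,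
      (hγ s).2]
  have ht : γ t ∈ c.source := mem_lineChart_source p
  have htar := hψtar t ht
  have htar' := c.open_target.mem_nhds htar
  -- The sign `a = ±1` is locally constant, so `d/dt = a ρ⁻¹ d/dr`; applied twice, `a² = 1` and the
  -- operator `ρ⁻¹ (ρ⁻¹ F')'` remains.
  set a := deriv ψ t * ρ (ψ t) with ha
  have haa : a * a = 1 := by rw [← abs_mul_abs_self, hψρ t ht, one_mul]
  have hsign : ∀ᶠ s in 𝓝 t, deriv ψ s = a * (ρ (ψ s))⁻¹ := by
    have hc1 : ContinuousAt (fun s ↦ deriv ψ s * ρ (ψ s)) t := by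
      have h1 : ContinuousAt (deriv ψ) t :=
        (((hψsm t ht).fderiv_right (m := 0) (by simp)).continuousAt).clm_apply continuousAt_const
      have h2 : ContinuousAt (fun s ↦ ρ (ψ s)) t :=
        ContinuousAt.comp (g := ρ) (hρsm.continuousOn.continuousAt htar')
          (hψsm t ht).continuousAt
      exact h1.mul h2
    have h1 : ∀ᶠ s in 𝓝 t, |deriv ψ s * ρ (ψ s) - a| < 1 :=
      Metric.continuousAt_iff'.1 hc1 1 one_pos
    filter_upwards [h1, hsrc] with s hs hs'
    have h3 : deriv ψ s * ρ (ψ s) = a := by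
      rcases eq_or_eq_neg_of_abs_eq (hψρ s hs') with h4 | h4 <;>
      rcases eq_or_eq_neg_of_abs_eq (hψρ t ht) with h5 | h5 <;>
      first | exact h4.trans h5.symm | (rw [h4, ha, h5] at hs; norm_num at hs)
    rw [← h3, mul_inv_cancel_right₀ (hρpos _ (hψtar s hs')).ne']
  set K : ℝ → ℂ := fun r ↦ (ρ r)⁻¹ • deriv F r with hK
  have hKd : DifferentiableAt ℝ K (ψ t) := by
    have h1 : DifferentiableAt ℝ ρ (ψ t) := (hρsm.contDiffAt htar').differentiableAt (by simp)
    have h2 : DifferentiableAt ℝ (deriv F) (ψ t) :=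
      (((hFsm.contDiffAt htar').fderiv_right (m := 1)
        (WithTop.coe_le_coe.2 le_top)).differentiableAt (by simp)).clm_apply
        (differentiableAt_const 1)
    exact (h1.inv (hρpos _ htar).ne').smul h2
  have hderiv1 : deriv (f ∘ γ) =ᶠ[𝓝 t] fun s ↦ a • K (ψ s) := by
    filter_upwards [hsign, hsrc, hsrc.eventually_nhds] with s hs hs' hs''
    have hFd : HasDerivAt F (deriv F (ψ s)) (ψ s) :=
      ((hFsm.contDiffAt (c.open_target.mem_nhds (hψtar s hs'))).differentiableAt
        (by simp)).hasDerivAt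
    have hev : f ∘ γ =ᶠ[𝓝 s] F ∘ ψ := by
      filter_upwards [hs''] with r hr
      simp only [hF, hψ, Function.comp, c.left_inv hr]
    rw [hev.deriv_eq, (hFd.scomp s (hψd s hs')).deriv, hs, hK, mul_smul]
  rw [laplaceBeltrami_eq_deriv, hderiv1.deriv_eq]
  have h := ((hKd.hasDerivAt.scomp t (hψd t ht)).const_smul a).deriv
  have h' : deriv (fun s ↦ a • K (ψ s)) t = a • deriv ψ t • deriv K (ψ t) := h
  rw [h', hsign.self_of_nhds, smul_smul, ← mul_assoc, haa, one_mul]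
  rfl

end Laplacian

/-! ### Orthonormal systems of periodic eigenfunctions of the second derivative -/

section Periodic

open scoped ComplexConjugate

variable {L : ℝ}

theorem Function.Periodic.deriv_periodic {h : ℝ → ℂ} (hper : Function.Periodic h L) :
    Function.Periodic (deriv h) L := by
  intro t
  rw [← deriv_comp_add_const]
  exact congrArg (fun g ↦ deriv g t) (funext hper)

theorem contDiff_deriv_of_contDiff {h : ℝ → ℂ} (hh : ContDiff ℝ ∞ h) : ContDiff ℝ ∞ (deriv h) :=
  (contDiff_infty_iff_deriv.1 hh).2

theorem hasDerivAt_of_contDiff {h : ℝ → ℂ} (hh : ContDiff ℝ ∞ h) (t : ℝ) :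
    HasDerivAt h (deriv h t) t :=
  (hh.differentiable (by simp) t).hasDerivAt

/-- Integration by parts for periodic functions. -/
theorem integral_conj_deriv_mul {h k : ℝ → ℂ} (hh : ContDiff ℝ ∞ h) (hk : ContDiff ℝ ∞ k)
    (hhp : Function.Periodic h L) (hkp : Function.Periodic k L) :
    ∫ t in 0..L, conj (deriv h t) * k t = -∫ t in 0..L, conj (h t) * deriv k t := by
  have hd : ∀ t ∈ uIcc 0 L, HasDerivAt (fun t ↦ conj (h t) * k t)
      (conj (deriv h t) * k t + conj (h t) * deriv k t) t := fun t _ ↦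
    (hasDerivAt_of_contDiff hh t).star.mul (hasDerivAt_of_contDiff hk t)
  have c1 : Continuous fun t ↦ conj (deriv h t) * k t :=
    (Complex.continuous_conj.comp (contDiff_deriv_of_contDiff hh).continuous).mul hk.continuous
  have c2 : Continuous fun t ↦ conj (h t) * deriv k t :=
    (Complex.continuous_conj.comp hh.continuous).mul (contDiff_deriv_of_contDiff hk).continuous
  have := intervalIntegral.integral_eq_sub_of_hasDerivAt hd
    ((c1.add c2).intervalIntegrable _ _)
  rw [intervalIntegral.integral_add (c1.intervalIntegrable _ _) (c2.intervalIntegrable _ _),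
    hhp.eq, hkp.eq, sub_self] at this
  exact eq_neg_of_add_eq_zero_left this

/-- Periodic eigenfunctions for distinct eigenvalues are orthogonal. -/
theorem integral_conj_mul_eq_zero_of_ne {h k : ℝ → ℂ} (hh : ContDiff ℝ ∞ h) (hk : ContDiff ℝ ∞ k)
    (hhp : Function.Periodic h L) (hkp : Function.Periodic k L) {a b : ℝ} (hab : a ≠ b)
    (ha : ∀ t, deriv (deriv h) t = a * h t) (hb : ∀ t, deriv (deriv k) t = b * k t) :
    ∫ t in 0..L, conj (h t) * k t = 0 := by
  -- Two integrations by parts make the second derivative symmetric, so `a - b` annihilates the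
  -- integral.
  have h1 := integral_conj_deriv_mul (contDiff_deriv_of_contDiff hh) hk hhp.deriv_periodic hkp
  have h2 := integral_conj_deriv_mul hh (contDiff_deriv_of_contDiff hk) hhp hkp.deriv_periodic
  rw [h2, neg_neg] at h1
  simp only [ha, hb, map_mul, Complex.conj_ofReal] at h1
  have h3 : ∀ t, conj (h t) * (b * k t) = b * (conj (h t) * k t) := fun t ↦ by ring
  simp only [mul_assoc, h3] at h1
  rw [intervalIntegral.integral_const_mul, intervalIntegral.integral_const_mul,
    ← sub_eq_zero, ← sub_mul] at h1
  refine (mul_eq_zero.1 h1).resolve_left ?_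
  rw [← Complex.ofReal_sub, Complex.ofReal_eq_zero]
  exact sub_ne_zero.2 hab

/-- A solution of `h'' = -l² h` with vanishing initial data is zero. -/
theorem eq_zero_of_deriv_deriv_eq {h : ℝ → ℂ} (hh : ContDiff ℝ ∞ h) {l : ℝ}
    (hl : ∀ t, deriv (deriv h) t = -(l : ℂ) ^ 2 * h t) (h0 : h 0 = 0) (h1 : deriv h 0 = 0) (t : ℝ) :
    h t = 0 := by
  have hd := fun t ↦ hasDerivAt_of_contDiff hh t
  have hd' := fun t ↦ hasDerivAt_of_contDiff (contDiff_deriv_of_contDiff hh) t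
  -- The energy is conserved and vanishes at `0`. Only `h' = 0` is extracted from it, so that `l =
  -- 0` needs no separate case.
  set N : ℝ → ℂ := fun t ↦ conj (deriv h t) * deriv h t + (l : ℂ) ^ 2 * (conj (h t) * h t) with hN
  have hNd : ∀ t, HasDerivAt N 0 t := by
    intro t
    have := (((hd' t).star.mul (hd' t)).add (((hd t).star.mul (hd t)).const_mul ((l : ℂ) ^ 2)))
    convert! this using 1
    simp only [hl]
    simp only [← starRingEnd_apply, map_mul, map_neg, map_pow, Complex.conj_ofReal]
    ring
  have hconst : ∀ t, N t = N 0 := fun t ↦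
    is_const_of_deriv_eq_zero (fun s ↦ (hNd s).differentiableAt) (fun s ↦ (hNd s).deriv) t 0
  have hder0 : ∀ t, deriv h t = 0 := by
    intro t
    have h2 := hconst t
    simp only [hN, h0, h1, map_zero, mul_zero, add_zero] at h2
    rw [← Complex.normSq_eq_conj_mul_self, ← Complex.normSq_eq_conj_mul_self] at h2
    have h3 : Complex.normSq (deriv h t) + l ^ 2 * Complex.normSq (h t) = 0 := by
      exact_mod_cast h2
    have h4 := Complex.normSq_nonneg (deriv h t)
    have h5 := mul_nonneg (sq_nonneg l) (Complex.normSq_nonneg (h t))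
    exact Complex.normSq_eq_zero.1 (by linarith)
  rw [is_const_of_deriv_eq_zero (fun s ↦ (hd s).differentiableAt) hder0 t 0, h0]

/-- Data of an orthonormal basis of the periodic functions consisting of eigenfunctions of the
second derivative. -/
structure PeriodicEigenbasis (L : ℝ) (h : ℕ → ℝ → ℂ) (l : ℕ → ℝ) : Prop where
  contDiff : ∀ j, ContDiff ℝ ∞ (h j)
  periodic : ∀ j, Function.Periodic (h j) L
  deriv_deriv : ∀ j t, deriv (deriv (h j)) t = -(l j : ℂ) ^ 2 * h j t
  nonneg : ∀ j, 0 ≤ l j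
  orthonormal : ∀ j k, ∫ t in 0..L, conj (h j t) * h k t = if j = k then 1 else 0
  complete : ∀ g : ℝ → ℂ, Continuous g → Function.Periodic g L →
    (∀ j, ∫ t in 0..L, conj (h j t) * g t = 0) → ∀ t, g t = 0

namespace PeriodicEigenbasis

variable {h : ℕ → ℝ → ℂ} {l : ℕ → ℝ}

theorem continuous_conj_mul (H : PeriodicEigenbasis L h l) {g : ℝ → ℂ} (hg : Continuous g) (j : ℕ) :
    Continuous fun t ↦ conj (h j t) * g t :=
  (Complex.continuous_conj.comp (H.contDiff j).continuous).mul hg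

theorem integral_conj_mul_sum (H : PeriodicEigenbasis L h l) (s : Finset ℕ) (a : ℕ → ℂ) (m : ℕ) :
    ∫ t in 0..L, conj (h m t) * ∑ k ∈ s, a k * h k t = if m ∈ s then a m else 0 := by
  have h1 : ∀ t, conj (h m t) * ∑ k ∈ s, a k * h k t = ∑ k ∈ s, a k * (conj (h m t) * h k t) := by
    intro t
    rw [Finset.mul_sum]
    exact Finset.sum_congr rfl fun k _ ↦ by ring
  simp only [h1]
  rw [intervalIntegral.integral_finsetSum fun k _ ↦
    ((H.continuous_conj_mul (H.contDiff k).continuous m).const_mul (a k)).intervalIntegrable _ _]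
  simp only [intervalIntegral.integral_const_mul, H.orthonormal, mul_ite, mul_one, mul_zero]
  exact Finset.sum_ite_eq s m a

/-- Each eigenvalue has finite multiplicity. -/
theorem finite_setOf_eq (H : PeriodicEigenbasis L h l) (c : ℝ) : {j | l j = c}.Finite := by
  -- Initial data embed the eigenspace in `ℂ × ℂ`: a combination with zero data vanishes
  -- identically, and orthonormality then kills its coefficients.
  have hli : LinearIndepOn ℂ (fun j ↦ (h j 0, deriv (h j) 0)) {j | l j = c} := by
    rw [linearIndepOn_iff']
    intro s a hs h0 i hi
    rw [Prod.ext_iff, Prod.fst_sum, Prod.snd_sum] at h0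
    set g : ℝ → ℂ := fun t ↦ ∑ j ∈ s, a j * h j t with hg
    have hgd : deriv g = fun t ↦ ∑ j ∈ s, a j * deriv (h j) t := funext fun t ↦
      (HasDerivAt.fun_sum fun j _ ↦ (hasDerivAt_of_contDiff (H.contDiff j) t).const_mul (a j)).deriv
    have hgdd : deriv (deriv g) = fun t ↦ ∑ j ∈ s, a j * deriv (deriv (h j)) t := by
      rw [hgd]
      exact funext fun t ↦ (HasDerivAt.fun_sum fun j _ ↦ (hasDerivAt_of_contDiff
        (contDiff_deriv_of_contDiff (H.contDiff j)) t).const_mul (a j)).deriv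
    have hgs : ContDiff ℝ ∞ g := ContDiff.sum fun j _ ↦ contDiff_const.mul (H.contDiff j)
    have hzero := eq_zero_of_deriv_deriv_eq hgs (l := c) (fun t ↦ by
      rw [hgdd, hg]
      simp only
      rw [Finset.mul_sum]
      refine Finset.sum_congr rfl fun j hj ↦ ?_
      rw [H.deriv_deriv, show l j = c from hs hj]
      ring) (by simpa using h0.1) (by rw [hgd]; simpa using h0.2)
    have := H.integral_conj_mul_sum s a i
    rw [if_pos hi] at this
    rw [← this]
    have hz : ∀ t, ∑ k ∈ s, a k * h k t = 0 := hzero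
    simp [hz]
  have := hli.linearIndependent.finite_of_isNoetherian
  exact Set.toFinite _

/-- The derivative acts on each eigenspace. -/
theorem deriv_eq_sum (H : PeriodicEigenbasis L h l) {s : Finset ℕ} {c : ℝ}
    (hs : ∀ j, j ∈ s ↔ l j = c) {j : ℕ} (hj : j ∈ s) (t : ℝ) :
    deriv (h j) t = ∑ k ∈ s, (∫ r in 0..L, conj (h k r) * deriv (h j) r) * h k t := by
  set a : ℕ → ℂ := fun k ↦ ∫ r in 0..L, conj (h k r) * deriv (h j) r with ha
  have hds : ContDiff ℝ ∞ (deriv (h j)) := contDiff_deriv_of_contDiff (H.contDiff j)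
  have hss : Continuous fun t ↦ ∑ k ∈ s, a k * h k t :=
    continuous_finsetSum _ fun k _ ↦ continuous_const.mul (H.contDiff k).continuous
  have hdd : ∀ t, deriv (deriv (deriv (h j))) t = -(l j : ℂ) ^ 2 * deriv (h j) t := by
    intro t
    rw [show deriv (deriv (h j)) = fun t ↦ -(l j : ℂ) ^ 2 * h j t from funext (H.deriv_deriv j)]
    exact ((hasDerivAt_of_contDiff (H.contDiff j) t).const_mul _).deriv
  -- The difference is orthogonal to every `h m`: by the choice of `a` if `m ∈ s`, and otherwise
  -- because `(h j)'` is again an eigenfunction for `l j`. Nonnegativity of the frequencies makes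
  -- their squares distinct.
  have := H.complete (fun t ↦ deriv (h j) t - ∑ k ∈ s, a k * h k t)
    (hds.continuous.sub hss)
    (fun t ↦ by
      simp only [(H.periodic j).deriv_periodic t, fun k ↦ H.periodic k t])
    (fun m ↦ by
      simp only [mul_sub]
      rw [intervalIntegral.integral_sub
        ((H.continuous_conj_mul hds.continuous m).intervalIntegrable _ _)
        ((H.continuous_conj_mul hss m).intervalIntegrable _ _), H.integral_conj_mul_sum]
      split_ifs with hm
      · simp [ha]
      · rw [sub_zero]
        refine integral_conj_mul_eq_zero_of_ne (H.contDiff m) hds (H.periodic m)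
          (H.periodic j).deriv_periodic (a := -(l m) ^ 2) (b := -(l j) ^ 2) ?_ ?_ ?_
        · intro h2
          have h3 := (sq_eq_sq₀ (H.nonneg m) (H.nonneg j)).1 (neg_injective h2)
          exact hm ((hs m).2 (h3.trans ((hs j).1 hj)))
        · intro t; rw [H.deriv_deriv]; push_cast; rfl
        · intro t; rw [hdd]; push_cast; rfl) t
  exact sub_eq_zero.1 this

/-- The sum of the squares of the eigenfunctions for one eigenvalue is constant. -/
theorem sum_norm_sq_eq (H : PeriodicEigenbasis L h l) (hL : 0 < L) {s : Finset ℕ} {c : ℝ}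
    (hs : ∀ j, j ∈ s ↔ l j = c) (t : ℝ) : ∑ j ∈ s, ‖h j t‖ ^ 2 = s.card / L := by
  set N : ℝ → ℂ := fun t ↦ ∑ j ∈ s, conj (h j t) * h j t with hN
  set D : ℕ → ℕ → ℂ := fun k j ↦ ∫ r in 0..L, conj (h k r) * deriv (h j) r with hD
  have hDanti : ∀ j k, conj (D j k) = -D k j := by
    intro j k
    have h1 := integral_conj_deriv_mul (H.contDiff k) (H.contDiff j) (H.periodic k) (H.periodic j)
    simp only [hD]
    rw [← h1]
    rw [intervalIntegral, intervalIntegral, map_sub, ← integral_conj, ← integral_conj]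
    simp only [map_mul, Complex.conj_conj, mul_comm]
  have hNd : ∀ t, HasDerivAt N 0 t := by
    intro t
    have h1 : HasDerivAt N
        (∑ j ∈ s, (conj (deriv (h j) t) * h j t + conj (h j t) * deriv (h j) t)) t :=
      HasDerivAt.fun_sum fun j _ ↦ (hasDerivAt_of_contDiff (H.contDiff j) t).star.mul
        (hasDerivAt_of_contDiff (H.contDiff j) t)
    convert! h1 using 1
    have h2 : ∀ j ∈ s, conj (deriv (h j) t) * h j t + conj (h j t) * deriv (h j) t =
        (∑ k ∈ s, -(D j k * (conj (h k t) * h j t))) + ∑ k ∈ s, D k j * (conj (h j t) * h k t) := by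
      intro j hj
      rw [H.deriv_eq_sum hs hj t, map_sum, Finset.sum_mul, Finset.mul_sum]
      congr 1
      · refine Finset.sum_congr rfl fun k _ ↦ ?_
        change conj (D k j * h k t) * h j t = _
        rw [map_mul, hDanti]
        ring
      · refine Finset.sum_congr rfl fun k _ ↦ ?_
        change conj (h j t) * (D k j * h k t) = _
        ring
    -- After exchanging the indices in the first double sum, the anti-Hermitian terms cancel in
    -- pairs.
    rw [Finset.sum_congr rfl h2, Finset.sum_add_distrib]
    conv_rhs =>
      enter [1]
      rw [Finset.sum_comm]
    rw [← Finset.sum_add_distrib]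
    refine (Finset.sum_eq_zero fun j _ ↦ ?_).symm
    rw [← Finset.sum_add_distrib]
    exact Finset.sum_eq_zero fun k _ ↦ neg_add_cancel _
  have hconst : ∀ r, N r = N t := fun r ↦
    is_const_of_deriv_eq_zero (fun s ↦ (hNd s).differentiableAt) (fun s ↦ (hNd s).deriv) r t
  have hint : ∫ r in 0..L, N r = s.card := by
    simp only [hN]
    rw [intervalIntegral.integral_finsetSum fun k _ ↦
      (H.continuous_conj_mul (H.contDiff k).continuous k).intervalIntegrable _ _]
    simp [H.orthonormal]
  simp only [hconst] at hint
  rw [intervalIntegral.integral_const, sub_zero] at hint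
  have hreal : N t = ((∑ j ∈ s, ‖h j t‖ ^ 2 : ℝ) : ℂ) := by
    simp only [hN]
    push_cast
    exact Finset.sum_congr rfl fun j _ ↦ Complex.conj_mul' _
  rw [hreal, Complex.real_smul, ← Complex.ofReal_mul] at hint
  rw [eq_div_iff hL.ne', mul_comm]
  exact_mod_cast hint

end PeriodicEigenbasis

end Periodic

/-! ### Two projections in a Hilbert space -/

section Projections

variable {H : Type*} [NormedAddCommGroup H] [InnerProductSpace ℂ H]

/-- If the orthogonal projection `Q` and the projection onto the span of finitely many orthonormal
vectors `bⱼ` both nearly preserve `f`, then the Hilbert-Schmidt norm of the product of the two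
projections is not small. -/
theorem sq_le_sum_norm_sq_of_concentrated {ι : Type*} {b : ι → H} (hb : Orthonormal ℂ b)
    (s : Finset ι) {Q : H → H} (hQ : ∀ f g, inner ℂ (Q f) g = inner ℂ (Q f) (Q g)) {f : H}
    (hf : f ≠ 0) {ε ε' : ℝ} (hε : 0 < 1 - ε - ε') (h₁ : (1 - ε) * ‖f‖ ^ 2 ≤ ‖Q f‖ ^ 2)
    (h₂ : (1 - ε') * ‖f‖ ^ 2 ≤ ∑ j ∈ s, ‖inner ℂ (b j) f‖ ^ 2) :
    (1 - ε - ε') ^ 2 ≤ ∑ j ∈ s, ‖Q (b j)‖ ^ 2 := by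
  set c : ι → ℂ := fun j ↦ inner ℂ (b j) f with hc
  set P : H := ∑ j ∈ s, c j • b j with hP
  set β : ℝ := ∑ j ∈ s, ‖c j‖ ^ 2 with hβ
  set K : ℝ := ∑ j ∈ s, ‖Q (b j)‖ ^ 2 with hK
  have hPβ : ‖P‖ ^ 2 = β := by
    have h := hb.inner_sum c c s
    have h' : (inner ℂ P P : ℂ) = (β : ℂ) := by
      rw [hP, h, hβ]
      push_cast
      exact Finset.sum_congr rfl fun j _ ↦ Complex.conj_mul' _
    rw [← inner_self_eq_norm_sq (𝕜 := ℂ), h']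
    exact Complex.ofReal_re β
  have hPf : RCLike.re (inner ℂ P f : ℂ) = β := by
    have h' : (inner ℂ P f : ℂ) = (β : ℂ) := by
      rw [hP, sum_inner, hβ]
      push_cast
      refine Finset.sum_congr rfl fun j _ ↦ ?_
      rw [inner_smul_left]
      exact Complex.conj_mul' _
    rw [h']
    exact Complex.ofReal_re β
  have hQf : RCLike.re (inner ℂ (Q f) f : ℂ) = ‖Q f‖ ^ 2 := by
    rw [hQ, inner_self_eq_norm_sq]
  have hβ0 : 0 ≤ β := Finset.sum_nonneg fun _ _ ↦ sq_nonneg _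
  have hK0 : 0 ≤ K := Finset.sum_nonneg fun _ _ ↦ sq_nonneg _
  -- The cross term carries the factor `√K`, the Hilbert-Schmidt norm: `hQ` moves `Q` onto each `b
  -- j`, and Cauchy-Schwarz is applied to the sum.
  have hQP : ‖(inner ℂ (Q f) P : ℂ)‖ ≤ ‖Q f‖ * (√β * √K) := by
    calc ‖(inner ℂ (Q f) P : ℂ)‖ = ‖∑ j ∈ s, c j * inner ℂ (Q f) (Q (b j))‖ := by
          rw [hP, inner_sum]
          congr 1
          refine Finset.sum_congr rfl fun j _ ↦ ?_
          rw [inner_smul_right, hQ]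
      _ ≤ ∑ j ∈ s, ‖Q f‖ * (‖c j‖ * ‖Q (b j)‖) := by
          refine (norm_sum_le _ _).trans (Finset.sum_le_sum fun j _ ↦ ?_)
          rw [norm_mul, mul_left_comm]
          exact mul_le_mul_of_nonneg_left (norm_inner_le_norm _ _) (norm_nonneg _)
      _ ≤ ‖Q f‖ * (√β * √K) := by
          rw [← Finset.mul_sum]
          exact mul_le_mul_of_nonneg_left (Real.sum_mul_le_sqrt_mul_sqrt _ _ _) (norm_nonneg _)
  set q : ℝ := ‖Q f‖
  set r : ℝ := ‖f‖
  have hr : 0 < r := norm_pos_iff.2 hf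
  have hq : 0 ≤ q := norm_nonneg _
  have hsum : q ^ 2 + β ≤ ‖Q f + P‖ * r := by
    rw [← hQf, ← hPf, ← map_add, ← inner_add_left]
    exact re_inner_le_norm _ _
  have hnorm : ‖Q f + P‖ ^ 2 ≤ (1 + √K) * (q ^ 2 + β) := by
    rw [norm_add_sq (𝕜 := ℂ), hPβ]
    have h1 : RCLike.re (inner ℂ (Q f) P : ℂ) ≤ q * (√β * √K) := (RCLike.re_le_norm _).trans hQP
    have h2 : 2 * (q * √β) ≤ q ^ 2 + β := by
      nlinarith [sq_nonneg (q - √β), Real.sq_sqrt hβ0]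
    nlinarith [mul_le_mul_of_nonneg_right h2 (Real.sqrt_nonneg K)]
  have hpos : 0 < q ^ 2 + β := by nlinarith [pow_pos hr 2]
  have h3 : (q ^ 2 + β) * (q ^ 2 + β) ≤ (1 + √K) * r ^ 2 * (q ^ 2 + β) := by
    calc (q ^ 2 + β) * (q ^ 2 + β) ≤ (‖Q f + P‖ * r) * (‖Q f + P‖ * r) :=
          mul_self_le_mul_self hpos.le hsum
      _ = ‖Q f + P‖ ^ 2 * r ^ 2 := by ring
      _ ≤ (1 + √K) * (q ^ 2 + β) * r ^ 2 := mul_le_mul_of_nonneg_right hnorm (sq_nonneg _)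
      _ = _ := by ring
  have h4 : q ^ 2 + β ≤ (1 + √K) * r ^ 2 := le_of_mul_le_mul_right h3 hpos
  -- The hypotheses bound `q ^ 2 + β` below by `(2 - ε - ε') * r ^ 2`. Testing `f` against the sum
  -- `Q f + P` is what lets the two losses add.
  have h5 : (1 - ε - ε') * r ^ 2 ≤ √K * r ^ 2 := by linarith
  have h6 : 1 - ε - ε' ≤ √K := le_of_mul_le_mul_right h5 (pow_pos hr 2)
  calc (1 - ε - ε') ^ 2 ≤ √K ^ 2 := pow_le_pow_left₀ hε.le h6 2
    _ = K := Real.sq_sqrt hK0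

end Projections

/-! ### Restriction to a set in `L²` -/

section Indicator

variable {X : Type*} [MeasurableSpace X] {μ : Measure X} {E : Set X}

/-- Multiplication by the indicator function of `E` in `L²`. -/
noncomputable def indicatorLp (hE : MeasurableSet E) (f : Lp ℂ 2 μ) : Lp ℂ 2 μ :=
  ((Lp.memLp f).indicator hE).toLp

theorem indicatorLp_ae_eq (hE : MeasurableSet E) (f : Lp ℂ 2 μ) :
    indicatorLp hE f =ᵐ[μ] E.indicator f := MemLp.coeFn_toLp _

/-- This is the cutoff as an orthogonal projection, in the form `hQ` of the Hilbert space
inequality. -/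
theorem inner_indicatorLp (hE : MeasurableSet E) (f g : Lp ℂ 2 μ) :
    inner ℂ (indicatorLp hE f) g = inner ℂ (indicatorLp hE f) (indicatorLp hE g) := by
  rw [L2.inner_def, L2.inner_def]
  refine integral_congr_ae ?_
  filter_upwards [indicatorLp_ae_eq hE f, indicatorLp_ae_eq hE g] with x hf hg
  rw [hf, hg]
  by_cases hx : x ∈ E <;> simp [hx]

theorem norm_sq_indicatorLp (hE : MeasurableSet E) (f : Lp ℂ 2 μ) :
    ‖indicatorLp hE f‖ ^ 2 = ∫ x in E, ‖f x‖ ^ 2 ∂μ := by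
  rw [← inner_self_eq_norm_sq (𝕜 := ℂ), ← integral_indicator hE, L2.inner_def]
  have h : ∫ x, (inner ℂ (indicatorLp hE f x) (indicatorLp hE f x) : ℂ) ∂μ =
      ∫ x, ((E.indicator (fun x ↦ ‖f x‖ ^ 2) x : ℝ) : ℂ) ∂μ := by
    refine integral_congr_ae ?_
    filter_upwards [indicatorLp_ae_eq hE f] with x hf
    rw [hf, inner_self_eq_norm_sq_to_K]
    by_cases hx : x ∈ E <;> simp [hx]
  rw [h, integral_complex_ofReal]
  exact Complex.ofReal_re _

end Indicator

theorem Set.Finite.tsum_subtype_eq_sum {ι : Type*} {A : Set ι} (hA : A.Finite) (g : ι → ℝ) :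
    ∑' j : A, g j = ∑ j ∈ hA.toFinset, g j := by
  lift A to Finset ι using hA
  rw [Finset.finite_toSet_toFinset]
  exact Finset.tsum_subtype' A g

theorem Function.Periodic.map_toIocMod {X : Type*} {L : ℝ} {f : ℝ → X}
    (hf : Function.Periodic f L) (hL : 0 < L) (a t : ℝ) : f (toIocMod hL a t) = f t :=
  hf.sub_zsmul_eq _

theorem integral_map_restrict_Ioc {X : Type*} [TopologicalSpace X] [MeasurableSpace X]
    [BorelSpace X] {L : ℝ} {γ : ℝ → X} (hL : 0 < L) (hcont : Continuous γ) {G : X → ℂ}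
    (hG : Continuous G) :
    ∫ x, G x ∂((volume.restrict (Ioc 0 L)).map γ) = ∫ t in 0..L, G (γ t) := by
  rw [integral_map hcont.aemeasurable hG.aestronglyMeasurable,
    intervalIntegral.integral_of_le hL.le]

/-! ### Eigenbases and arc length -/

section Eigenbasis

open scoped ComplexConjugate

variable {M : Type*} [TopologicalSpace M] [CompactSpace M] [MeasurableSpace M] [BorelSpace M]
    [ChartedSpace (EuclideanSpace ℝ (Fin 1)) M] [IsManifold (𝓡 1) ∞ M]
    [RiemannianBundle (fun x : M ↦ TangentSpace (𝓡 1) x)]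
    [IsContMDiffRiemannianBundle (𝓡 1) ∞ (EuclideanSpace ℝ (Fin 1))
      (fun x : M ↦ TangentSpace (𝓡 1) x)] {L : ℝ} {γ : ℝ → M}

/-- The eigenfunctions of the Laplace-Beltrami operator, read in an arc length parametrization. -/
theorem LaplaceEigenbasis.periodicEigenbasis (B : LaplaceEigenbasis 1 M) (hL : 0 < L)
    (hγ : ∀ t, IsUnitSpeedAt γ t) (hper : Function.Periodic γ L) (hinj : InjOn γ (Ioc 0 L))
    (himg : γ '' Ioc 0 L = univ) (hopen : IsOpenMap γ) :
    PeriodicEigenbasis L (fun j ↦ B.e j ∘ γ) B.freq := by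
  have hμ := riemannianVolume_eq_map hγ hinj himg
  have hcont := continuous_of_isUnitSpeedAt hγ
  have hec : ∀ j, Continuous (B.e j) := fun j ↦ (B.contMDiff j).continuous
  have hγs : ContMDiff 𝓘(ℝ, ℝ) (𝓡 1) ∞ γ := fun t ↦ (hγ t).1
  have hfin : IsFiniteMeasure (riemannianVolume 1 M) := by rw [hμ]; infer_instance
  -- The volume is the push-forward of length, so inner products on `M` become integrals over one
  -- period.
  have hinner : ∀ (j : ℕ) (g : Lp ℂ 2 (riemannianVolume 1 M)) (G : M → ℂ), Continuous G →
      g =ᵐ[riemannianVolume 1 M] G →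
      inner ℂ (B.basis j) g = ∫ t in 0..L, conj (B.e j (γ t)) * G (γ t) := by
    intro j g G hG hg
    have hGc : Continuous fun x ↦ conj (B.e j x) * G x :=
      (Complex.continuous_conj.comp (hec j)).mul hG
    rw [← integral_map_restrict_Ioc hL hcont hGc, ← hμ, L2.inner_def]
    refine integral_congr_ae ?_
    filter_upwards [B.basis_ae_eq j, hg] with x hx hx'
    rw [hx, hx', RCLike.inner_apply, mul_comm]
  refine ⟨fun j ↦ ?_, fun j t ↦ ?_, fun j t ↦ ?_, fun j ↦ ?_, fun j k ↦ ?_, fun g hg hgp hzero ↦ ?_⟩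
  · exact contMDiff_iff_contDiff.1 ((B.contMDiff j).comp hγs)
  · simp only [Function.comp, hper t]
  · have := B.eigen j (γ t)
    rw [laplaceBeltrami_eq_deriv_deriv (B.contMDiff j) hγ] at this
    rw [neg_mul, Function.comp_apply, ← this, neg_neg]
  · rw [← B.freq_zero]
    exact B.freq_mono (Nat.zero_le j)
  · have h1 := hinner j (B.basis k) (B.e k) (hec k) (B.basis_ae_eq k)
    rw [orthonormal_iff_ite.1 B.basis.orthonormal] at h1
    exact h1.symm
  · have hsurj : Function.Surjective γ := fun x ↦ by
      obtain ⟨t, -, ht⟩ : x ∈ γ '' Ioc 0 L := himg ▸ mem_univ x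
      exact ⟨t, ht⟩
    have hperiod : ∀ s t, γ s = γ t → g s = g t := by
      intro s t hst
      have hIoc : Ioc (0 : ℝ) L = Ioc 0 (0 + L) := by rw [zero_add]
      have h1 : ∀ t, ∃ t' ∈ Ioc 0 L, γ t' = γ t ∧ g t' = g t := by
        intro t
        refine ⟨toIocMod hL 0 t, hIoc ▸ toIocMod_mem_Ioc hL 0 t, ?_, ?_⟩
        · exact hper.map_toIocMod hL 0 t
        · exact hgp.map_toIocMod hL 0 t
      obtain ⟨s', hs', hs1, hs2⟩ := h1 s
      obtain ⟨t', ht', ht1, ht2⟩ := h1 t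
      rw [← hs2, ← ht2, hinj hs' ht' (by rw [hs1, ht1, hst])]
    choose v hv using hsurj
    set G : M → ℂ := fun x ↦ g (v x) with hGdef
    have hGγ : ∀ t, G (γ t) = g t := fun t ↦ hperiod _ _ (hv (γ t))
    -- As an open surjection `γ` is a quotient map, so `g` descends continuously to `M`.
    -- Completeness of the basis gives zero almost everywhere, and continuity of `g` removes the
    -- exceptional set.
    have hGc : Continuous G := by
      refine (hopen.isQuotientMap hcont fun x ↦ ⟨v x, hv x⟩).continuous_iff.2 ?_
      exact hg.congr fun t ↦ (hGγ t).symm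
    have hGm : MemLp G 2 (riemannianVolume 1 M) :=
      hGc.memLp_of_hasCompactSupport (HasCompactSupport.of_compactSpace _)
    have h0 : hGm.toLp = 0 := by
      refine B.basis.repr.injective (lp.ext (funext fun j ↦ ?_))
      rw [map_zero, HilbertBasis.repr_apply_apply, hinner j _ G hGc hGm.coeFn_toLp]
      simp only [hGγ]
      exact hzero j
    have hae : G =ᵐ[riemannianVolume 1 M] 0 := by
      have := hGm.coeFn_toLp
      rw [h0] at this
      exact this.symm.trans (Lp.coeFn_zero _ _ _)
    rw [hμ] at hae
    have hae' : g =ᵐ[volume.restrict (Ioc 0 L)] fun _ ↦ 0 := by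
      filter_upwards [ae_of_ae_map hcont.aemeasurable hae] with t ht
      rw [← hGγ]
      exact ht
    have hIcc := Measure.eqOn_Ioc_of_ae_eq volume hae' hg.continuousOn continuousOn_const
    intro t
    have h1 := hIcc (x := toIocMod hL 0 t) (by simpa using toIocMod_mem_Ioc hL 0 t)
    rw [← hgp.map_toIocMod hL 0 t]
    exact h1

end Eigenbasis

/-! ### Finite sets of eigenvalues -/

namespace PeriodicEigenbasis

variable {L : ℝ} {h : ℕ → ℝ → ℂ} {l : ℕ → ℝ}

theorem finite_preimage (H : PeriodicEigenbasis L h l) {S : Set ℝ} (hS : S.Finite) :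
    (l ⁻¹' S).Finite :=
  hS.preimage' fun c _ ↦ H.finite_setOf_eq c

/-- The sum of the squares of the eigenfunctions for a set of eigenvalues is constant. -/
theorem sum_norm_sq_eq_of_preimage (H : PeriodicEigenbasis L h l) (hL : 0 < L) {S : Finset ℝ}
    {s : Finset ℕ} (hs : ∀ j, j ∈ s ↔ l j ∈ S) (t : ℝ) :
    ∑ j ∈ s, ‖h j t‖ ^ 2 = s.card / L := by
  have hmap : ∀ j ∈ s, l j ∈ S := fun j hj ↦ (hs j).1 hj
  rw [← Finset.sum_fiberwise_of_maps_to hmap, Finset.card_eq_sum_card_fiberwise hmap,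
    Nat.cast_sum, Finset.sum_div]
  refine Finset.sum_congr rfl fun c hc ↦ H.sum_norm_sq_eq (c := c) hL (fun j ↦ ?_) t
  rw [Finset.mem_filter, hs]
  exact ⟨fun hj ↦ hj.2, fun hj ↦ ⟨hj ▸ hc, hj⟩⟩

end PeriodicEigenbasis

/-! ### One period as a fundamental domain -/

section Circle

variable {M : Type*} [TopologicalSpace M] [ChartedSpace (EuclideanSpace ℝ (Fin 1)) M] {L : ℝ}
  [hL : Fact (0 < L)]

theorem Diffeomorph.periodic_coe_addCircle (Φ : AddCircle L ≃ₘ^∞⟮𝓘(ℝ, ℝ), 𝓡 1⟯ M) :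
    Function.Periodic (fun t : ℝ ↦ Φ t) L := fun t ↦ by
  simp only [AddCircle.coe_add_period]

theorem Diffeomorph.injOn_coe_addCircle (Φ : AddCircle L ≃ₘ^∞⟮𝓘(ℝ, ℝ), 𝓡 1⟯ M) :
    InjOn (fun t : ℝ ↦ Φ t) (Ioc 0 L) := by
  intro s hs t ht hst
  have h0 : 0 < L := hL.out
  have h1 : toIocMod h0 0 s = toIocMod h0 0 t :=
    congrArg (toIocMod_periodic h0 0).lift (Φ.injective hst)
  rwa [(toIocMod_eq_self h0).2 (by rwa [zero_add]),
    (toIocMod_eq_self h0).2 (by rwa [zero_add])] at h1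

theorem Diffeomorph.image_coe_addCircle (Φ : AddCircle L ≃ₘ^∞⟮𝓘(ℝ, ℝ), 𝓡 1⟯ M) :
    (fun t : ℝ ↦ Φ t) '' Ioc 0 L = univ := by
  refine eq_univ_of_forall fun x ↦ ?_
  obtain ⟨y, rfl⟩ := Φ.surjective x
  obtain ⟨t, rfl⟩ := QuotientAddGroup.mk_surjective y
  exact ⟨toIocMod hL.out 0 t, by simpa using toIocMod_mem_Ioc hL.out 0 t,
    Φ.periodic_coe_addCircle.map_toIocMod hL.out 0 t⟩

end Circle

theorem theorem1p4 {M : Type*} [TopologicalSpace M] [T2Space M] [CompactSpace M]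
    [ConnectedSpace M] [MeasurableSpace M] [BorelSpace M]
    [ChartedSpace (EuclideanSpace ℝ (Fin 1)) M] [IsManifold (𝓡 1) ∞ M]
    [RiemannianBundle (fun x : M ↦ TangentSpace (𝓡 1) x)]
    [IsContMDiffRiemannianBundle (𝓡 1) ∞ (EuclideanSpace ℝ (Fin 1))
      (fun x : M ↦ TangentSpace (𝓡 1) x)] :
    (∃ (L : ℝ) (_ : Fact (0 < L)) (Φ : AddCircle L ≃ₘ^∞⟮𝓘(ℝ, ℝ), 𝓡 1⟯ M),
      IsRiemannianIsometry Φ ∧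
      (∀ s : ℝ, ‖mfderiv 𝓘(ℝ, ℝ) (𝓡 1) (fun t : ℝ ↦ Φ (t : AddCircle L)) s (1 : ℝ)‖ = 1) ∧
      riemannianVolume 1 M univ = ENNReal.ofReal L) ∧
    ∀ B : LaplaceEigenbasis 1 M,
      (∀ μ : ℝ, (B.indexSet {μ}).Finite ∧
        ∀ x : M, ∑' j : B.indexSet {μ}, ‖B.e j x‖ ^ 2 =
          ((B.indexSet {μ}).ncard : ℝ) / (riemannianVolume 1 M).real univ) ∧
      ∀ (E : Set M) (S : Set ℝ) (f : Lp ℂ 2 (riemannianVolume 1 M)) (ε ε' : ℝ),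
        NullMeasurableSet E (riemannianVolume 1 M) →
        S.Finite → S ⊆ range B.freq → f ≠ 0 →
        0 ≤ ε → ε < 1 → 0 ≤ ε' → ε' < 1 → 0 < 1 - ε - ε' → 1 - ε - ε' ≤ 1 →
        (1 - ε) * ‖f‖ ^ 2 ≤ ∫ x in E, ‖f x‖ ^ 2 ∂riemannianVolume 1 M →
        (1 - ε') * ‖f‖ ^ 2 ≤ ∑' j : B.indexSet S, ‖B.coeff f j‖ ^ 2 →
        (1 - ε - ε') ^ 2 ≤
          (riemannianVolume 1 M).real E / (riemannianVolume 1 M).real univ *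
            ((B.indexSet S).ncard : ℝ) := by
  obtain ⟨L, hF, Φ, hΦ⟩ := exists_diffeomorph_isUnitSpeedAt (M := M)
  have hL : 0 < L := hF.out
  set γ : ℝ → M := fun t ↦ Φ t with hγdef
  have hinj : InjOn γ (Ioc 0 L) := Φ.injOn_coe_addCircle
  have himg : γ '' Ioc 0 L = univ := Φ.image_coe_addCircle
  have hμ := riemannianVolume_eq_map hΦ hinj himg
  have hvol : riemannianVolume 1 M univ = ENNReal.ofReal L := by
    rw [hμ, Measure.map_apply (continuous_of_isUnitSpeedAt hΦ).measurable MeasurableSet.univ,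
      preimage_univ, Measure.restrict_apply_univ, Real.volume_Ioc, sub_zero]
  have hfin : IsFiniteMeasure (riemannianVolume 1 M) := ⟨hvol ▸ ENNReal.ofReal_lt_top⟩
  have hvol' : (riemannianVolume 1 M).real univ = L := by
    rw [measureReal_def, hvol, ENNReal.toReal_ofReal hL.le]
  refine ⟨⟨L, hF, Φ, isRiemannianIsometry_of_isUnitSpeedAt Φ hΦ, fun s ↦ (hΦ s).2, hvol⟩,
    fun B ↦ ?_⟩
  have H := B.periodicEigenbasis hL hΦ Φ.periodic_coe_addCircle hinj himg
    (isOpenMap_of_isUnitSpeedAt hΦ)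
  have hX : ∀ S : Set ℝ, S.Finite → (B.indexSet S).Finite := fun S hS ↦ H.finite_preimage hS
  have hsum : ∀ (S : Set ℝ) (hS : S.Finite) (x : M), ∑ j ∈ (hX S hS).toFinset, ‖B.e j x‖ ^ 2 =
      ((B.indexSet S).ncard : ℝ) / L := by
    intro S hS x
    obtain ⟨t, -, rfl⟩ : x ∈ γ '' Ioc 0 L := himg ▸ mem_univ x
    rw [ncard_eq_toFinset_card _ (hX S hS)]
    refine H.sum_norm_sq_eq_of_preimage hL (S := hS.toFinset) (fun j ↦ ?_) t
    rw [Finite.mem_toFinset, Finite.mem_toFinset]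
    rfl
  refine ⟨fun l ↦ ⟨hX _ (finite_singleton l), fun x ↦ ?_⟩, ?_⟩
  · rw [(hX _ (finite_singleton l)).tsum_subtype_eq_sum fun j ↦ ‖B.e j x‖ ^ 2,
      hsum _ (finite_singleton l), hvol']
  · intro E S f ε ε' hE hS _ hf _ _ _ _ hεε _ h1 h2
    -- The cutoff needs a measurable set; an almost everywhere equal one changes neither the
    -- integral nor the volume.
    obtain ⟨E', -, hE', hEE'⟩ := hE.exists_measurable_superset_ae_eq
    rw [← Measure.restrict_congr_set hEE', ← norm_sq_indicatorLp hE'] at h1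
    rw [(hX S hS).tsum_subtype_eq_sum fun j ↦ ‖B.coeff f j‖ ^ 2] at h2
    -- What remains is an exact evaluation: the sum of `|e_j|²` over all of `X_S` is constant, so
    -- its integral over `E'` is that constant times the volume.
    refine (sq_le_sum_norm_sq_of_concentrated B.basis.orthonormal _ (inner_indicatorLp hE') hf
      hεε h1 h2).trans (le_of_eq ?_)
    have hint : ∀ j, Integrable (fun x ↦ ‖B.e j x‖ ^ 2)
        ((riemannianVolume 1 M).restrict E') := fun j ↦
      (((B.contMDiff j).continuous.norm.pow 2).integrable_of_hasCompactSupport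
        (HasCompactSupport.of_compactSpace _)).restrict
    calc ∑ j ∈ (hX S hS).toFinset, ‖indicatorLp hE' (B.basis j)‖ ^ 2
        = ∑ j ∈ (hX S hS).toFinset, ∫ x in E', ‖B.e j x‖ ^ 2 ∂riemannianVolume 1 M := by
          refine Finset.sum_congr rfl fun j _ ↦ ?_
          rw [norm_sq_indicatorLp]
          refine integral_congr_ae (ae_restrict_of_ae ?_)
          filter_upwards [B.basis_ae_eq j] with x hx
          rw [hx]
      _ = ∫ x in E', ((B.indexSet S).ncard : ℝ) / L ∂riemannianVolume 1 M := by
          rw [← integral_finsetSum _ fun j _ ↦ hint j]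
          simp only [hsum S hS]
      _ = _ := by
          rw [setIntegral_const, measureReal_congr hEE', hvol', smul_eq_mul]
          ring
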